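/- Lower bound, stochastic noise. For \(\sigma>0\) and integers \(n\ge p\), consider the mixed linear regression model with parameter \(\theta^*=(\beta_1^*,\beta_2^*)\in\mathbb{R}^p\times\mathbb{R}^p\): one observes \((X,y)\), where \(X\in\mathbb{R}^{n\times p}\) has rows \(x_1,\dots,x_n\) with i.i.d. \(N(0,1)\) entries, and \[ y_i=z_i\langle x_i,\beta_1^*\rangle+(1-z_i)\langle x_i,\beta_2^*\rangle+e_i,\qquad i=1,\dots,n, \] where the hidden labels \(z_i\) are i.i.d. Bernoulli\((1/2)\), the noise variables \(e_i\) are i.i.d. \(N(0,\sigma^2)\), and \(X,z,e\) are independent. Define the error, up to a permutation of the two regressors, by \[ \rho(\theta,\theta')=\min\bigl\{\|\beta_1-\beta_1'\|_2+\|\beta_2-\beta_2'\|_2,\ \|\beta_1-\beta_2'\|_2+\|\beta_2-\beta_1'\|_2\bigr\}, \] for \(\theta=(\beta_1,\beta_2)\) and \(\theta'=(\beta_1',\beta_2')\), and the parameter class by \[ \Theta(\gamma)=\bigl\{(\beta_1,\beta_2)\in\mathbb{R}^p\times\mathbb{R}^p:\ 2\|\beta_1-\beta_2\|_2\ge\|\beta_1\|_2+\|\beta_2\|_2\ge\gamma\bigr\}.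 \] Let \[ R(\gamma)=\inf_{\hat\theta}\ \sup_{\theta^*\in\Theta(\gamma)}\ \mathbb{E}_{X,z,e}\bigl[\rho(\theta^*,\hat\theta(X,y))\bigr]\in[0,\infty], \] where the infimum is over all measurable functions \(\hat\theta\) of \((X,y)\) with values in \(\mathbb{R}^p\times\mathbb{R}^p\). Then there are absolute constants \(0<c_0,c_1<1\) such that, for all integers \(n\ge p\ge 64\) and all \(\sigma>0\): 1. for every \(\gamma>\sigma\), \(\displaystyle R(\gamma)\ge c_0\,\sigma\sqrt{p/n}\); 2. for every \(\gamma\) with \(c_1\sigma(p/n)^{1/4}\le\gamma\le\sigma\), \(\displaystyle R(\gamma)\ge c_0\,\frac{\sigma^2}{\gamma}\sqrt{p/n}\); 3. for every \(\gamma\) with \(0<\gamma\le c_1\sigma(p/n)^{1/4}\), \(\displaystyle R(\gamma)\ge c_0\,\sigma(p/n)^{1/4}\). -/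

import Mathlib

open MeasureTheory ProbabilityTheory
open scoped ENNReal

noncomputable section

namespace MixedRegression

/-- A pair of regressors `θ = (β₁, β₂) ∈ ℝᵖ × ℝᵖ`, each factor with its Euclidean norm. -/
abbrev Regressors (p : ℕ) : Type :=
  EuclideanSpace ℝ (Fin p) × EuclideanSpace ℝ (Fin p)

/-- The total error in both regressors, up to a permutation of the two. -/
def rho {p : ℕ} (θ θ' : Regressors p) : ℝ :=
  min (‖θ.1 - θ'.1‖ + ‖θ.2 - θ'.2‖) (‖θ.1 - θ'.2‖ + ‖θ.2 - θ'.1‖)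

/-- The class `Θ(γ)` of pairs whose norms and separation are bounded below. -/
def paramClass (p : ℕ) (γ : ℝ) : Set (Regressors p) :=
  {θ | ‖θ.1‖ + ‖θ.2‖ ≤ 2 * ‖θ.1 - θ.2‖ ∧ γ ≤ ‖θ.1‖ + ‖θ.2‖}

/-- The space of designs: `X i j` is the `j`-th coordinate of the covariate `xᵢ`. -/
abbrev Design (n p : ℕ) : Type := Fin n → Fin p → ℝ

/-- The observed data `(X, y)`. -/
abbrev Data (n p : ℕ) : Type := Design n p × (Fin n → ℝ)

/-- The sources of randomness: design `X`, hidden labels `z ∈ {0,1}ⁿ`, noise `e`. -/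
abbrev Sample (n p : ℕ) : Type := Design n p × (Fin n → Fin 2) × (Fin n → ℝ)

/-- The Bernoulli(1/2) distribution on `{0, 1}`. -/
def labelLaw : Measure (Fin 2) :=
  bernoulliMeasure 1 0 ⟨1 / 2, by norm_num, by norm_num⟩

/-- The joint law of `(X, z, e)`: all entries are independent, those of `X` are `N(0, 1)`,
those of `z` are Bernoulli(1/2), those of `e` are `N(0, σ²)`. -/
def sampleLaw (n p : ℕ) (σ : ℝ) : Measure (Sample n p) :=
  (Measure.pi fun _ : Fin n => Measure.pi fun _ : Fin p => gaussianReal 0 1).prod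
    ((Measure.pi fun _ : Fin n => labelLaw).prod
      (Measure.pi fun _ : Fin n => gaussianReal 0 (Real.toNNReal (σ ^ 2))))

/-- The observed data under the parameter `θ = (β₁, β₂)`: the response is
`yᵢ = ⟨xᵢ, β₁⟩ + eᵢ` if `zᵢ = 1` and `yᵢ = ⟨xᵢ, β₂⟩ + eᵢ` if `zᵢ = 0`. -/
def observe {n p : ℕ} (θ : Regressors p) (ω : Sample n p) : Data n p :=
  (ω.1, fun i => ∑ j, ω.1 i j * (if ω.2.1 i = 1 then θ.1 j else θ.2 j) + ω.2.2 i)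

/-- The expected error `𝔼_{X,z,e} ρ(θ, θ̂(X, y))` of the estimator `est` when `θ` is the true
parameter, as an element of `[0, ∞]`. -/
def risk {n p : ℕ} (σ : ℝ) (est : Data n p → Regressors p) (θ : Regressors p) : ℝ≥0∞ :=
  ∫⁻ ω, ENNReal.ofReal (rho θ (est (observe θ ω))) ∂(sampleLaw n p σ)

/-- The minimax expected error over `Θ(γ)`: infimum over all measurable estimators of the
supremum over `Θ(γ)` of the expected error, as an element of `[0, ∞]`. -/
def minimaxRisk (n p : ℕ) (σ γ : ℝ) : ℝ≥0∞ :=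
  ⨅ (est : Data n p → Regressors p) (_ : Measurable est), ⨆ θ ∈ paramClass p γ, risk σ est θ

end MixedRegression

end

/-! Assouad's method on symmetric pairs (β, -β), with β = γ e_i + Σ_{j≠i} ±ε e_j. The fixed
coordinate γ places the pair in Θ(γ). For such pairs, swapping the regressors is a global sign
change of β; if pε² ≤ γ², getting this sign wrong costs at least as much as getting every free sign
wrong. Hence H wrongly decoded signs force ρ ≥ εH/√p (`mul_card_decodeErrors_le_rho`). If adjacent
vertices cannot be told apart, a constant fraction of the signs is wrong at some vertex, and the
risk is at least ε√p/8 (`le_minimaxRisk_of_likelihoodMoment_le`).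

Indistinguishability is measured by the second moment of the likelihood ratio, which is
multiplicative over observations and so must be 1 + O(1/n) for a single one. For nearby β, β' it is
at most 1 + K‖β-β'‖²/σ² (`likelihoodMoment_le_of_norm_sub`). For weak signals there is a gain: the
law of the data is even in β, so the excess also vanishes at β' = -β and acquires a factor
‖β+β'‖²/σ² (`likelihoodMoment_le_of_norm_add`).

The first bound allows ε ≍ σ/√n, the second ε ≍ σ²/(γ√n). In the second case pε² ≤ γ² amounts to γ ≳
σ(p/n)^{1/4}; below that level the risk is compared with its value at the threshold, since Θ(γ)
shrinks as γ grows. -/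

namespace MixedRegression

/-! ### The scalar mixture and second moments of its likelihood ratio -/

/-- The density, with respect to `N(0, v)`, of the equal mixture of `N(a, v)` and `N(-a, v)`. -/
noncomputable def mixtureDensity (v a y : ℝ) : ℝ :=
  Real.exp (-a ^ 2 / (2 * v)) * Real.cosh (a * y / v)

lemma mixtureDensity_pos (v a y : ℝ) : 0 < mixtureDensity v a y :=
  mul_pos (Real.exp_pos _) (Real.cosh_pos _)

lemma gaussianReal_eq_withDensity {v : NNReal} (hv : v ≠ 0) (a : ℝ) :
    gaussianReal a v = (gaussianReal 0 v).withDensity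
      fun y => ENNReal.ofReal (Real.exp (a * y / v - a ^ 2 / (2 * v))) := by
  have hv' : (v : ℝ) ≠ 0 := by exact_mod_cast hv
  rw [gaussianReal_of_var_ne_zero _ hv, gaussianReal_of_var_ne_zero _ hv,
    ← withDensity_mul _ (measurable_gaussianPDF _ _) (by fun_prop)]
  congr 1
  ext y
  rw [Pi.mul_apply, gaussianPDF, gaussianPDF,
    ← ENNReal.ofReal_mul (gaussianPDFReal_nonneg _ _ _)]
  congr 1
  rw [gaussianPDFReal, gaussianPDFReal, mul_assoc (√_)⁻¹, ← Real.exp_add]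
  congr 2
  field_simp
  ring

lemma labelLaw_eq : labelLaw = (2⁻¹ : ℝ≥0∞) • Measure.dirac 1 + (2⁻¹ : ℝ≥0∞) • Measure.dirac 0 := by
  have h : ∀ (c : NNReal) (i : Fin 2), (c : ℝ) = 1 / 2 →
      c • Measure.dirac i = (2⁻¹ : ℝ≥0∞) • Measure.dirac i := by
    intro c i hc
    have : c = 2⁻¹ := by
      apply NNReal.eq
      rw [hc]
      norm_num
    rw [this, ← ENNReal.coe_inv_two]
    rfl
  rw [labelLaw, bernoulliMeasure_def]
  congr 1
  · exact h _ _ rfl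
  · apply h
    simp [unitInterval.symm]
    norm_num

instance : IsProbabilityMeasure labelLaw := by
  rw [labelLaw]; infer_instance

lemma map_label_noise {v : NNReal} (hv : v ≠ 0) (a : ℝ) :
    (labelLaw.prod (gaussianReal 0 v)).map (fun q => (if q.1 = 1 then a else -a) + q.2) =
      (gaussianReal 0 v).withDensity fun y => ENNReal.ofReal (mixtureDensity v a y) := by
  have hm : Measurable fun q : Fin 2 × ℝ => (if q.1 = 1 then a else -a) + q.2 := by
    refine Measurable.add ?_ measurable_snd
    exact (measurable_of_finite fun i : Fin 2 => if i = 1 then a else -a).comp measurable_fst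
  have hd : ∀ i : Fin 2, ((Measure.dirac i).prod (gaussianReal 0 v)).map
      (fun q => (if q.1 = 1 then a else -a) + q.2) =
        gaussianReal (if i = 1 then a else -a) v := by
    intro i
    rw [Measure.dirac_prod, Measure.map_map hm (by fun_prop)]
    simpa [Function.comp_def] using
      gaussianReal_map_const_add (μ := 0) (v := v) (if i = 1 then a else -a)
  rw [labelLaw_eq, Measure.add_prod, Measure.prod_smul_left, Measure.prod_smul_left,
    Measure.map_add _ _ hm, Measure.map_smul, Measure.map_smul, hd, hd,
    if_pos rfl, if_neg (by decide), gaussianReal_eq_withDensity hv a,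
    gaussianReal_eq_withDensity hv (-a), ← withDensity_smul _ (by fun_prop),
    ← withDensity_smul _ (by fun_prop), ← withDensity_add_left (by fun_prop)]
  congr 1
  ext y
  simp only [Pi.add_apply, Pi.smul_apply, smul_eq_mul]
  have h2 : (2⁻¹ : ℝ≥0∞) = ENNReal.ofReal 2⁻¹ := by
    rw [ENNReal.ofReal_inv_of_pos (by norm_num)]; norm_num
  rw [h2, ← ENNReal.ofReal_mul (by norm_num), ← ENNReal.ofReal_mul (by norm_num),
    ← ENNReal.ofReal_add (by positivity) (by positivity), mixtureDensity, Real.cosh_eq]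
  congr 1
  rw [← mul_div_assoc, mul_add, ← Real.exp_add, ← Real.exp_add]
  have e1 : a * y / v - a ^ 2 / (2 * v) = -a ^ 2 / (2 * (v : ℝ)) + a * y / v := by ring
  have e2 : -a * y / v - (-a) ^ 2 / (2 * v) = -a ^ 2 / (2 * (v : ℝ)) + -(a * y / v) := by ring
  rw [e1, e2]
  ring

lemma integral_exp_mul_gaussianReal (v : NNReal) (t : ℝ) :
    ∫ y, Real.exp (t * y) ∂gaussianReal 0 v = Real.exp (v * t ^ 2 / 2) := by
  have := congrFun (mgf_fun_id_gaussianReal (μ := 0) (v := v)) t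
  simpa [mgf] using this

/-- The product of the two cosh factors is a sum of four exponentials, whose Gaussian means cancel
the prefactors and leave only exp(±ab/v). -/
lemma integrable_mixtureDensity_mul {v : NNReal} (hv : v ≠ 0) (a b : ℝ) :
    Integrable (fun y => mixtureDensity v a y * mixtureDensity v b y) (gaussianReal 0 v) ∧
    ∫ y, mixtureDensity v a y * mixtureDensity v b y ∂gaussianReal 0 v =
      Real.cosh (a * b / v) := by
  have hv' : (v : ℝ) ≠ 0 := by exact_mod_cast hv
  have hi : ∀ t : ℝ, Integrable (fun y => Real.exp (t * y)) (gaussianReal 0 v) :=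
    fun t => integrable_exp_mul_gaussianReal t
  have heq : (fun y => mixtureDensity v a y * mixtureDensity v b y) = fun y =>
      Real.exp (-(a ^ 2 + b ^ 2) / (2 * v)) / 4 *
        (Real.exp ((a + b) / v * y) + Real.exp (-((a + b) / v) * y) +
          (Real.exp ((a - b) / v * y) + Real.exp (-((a - b) / v) * y))) := by
    ext y
    have e0 : Real.exp (-(a ^ 2 + b ^ 2) / (2 * v)) =
        Real.exp (-a ^ 2 / (2 * v)) * Real.exp (-b ^ 2 / (2 * v)) := by
      rw [← Real.exp_add]; congr 1; ring
    have e1 : Real.exp ((a + b) / v * y) = Real.exp (a * y / v) * Real.exp (b * y / v) := by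
      rw [← Real.exp_add]; congr 1; ring
    have e2 : Real.exp (-((a + b) / v) * y) =
        Real.exp (-(a * y / v)) * Real.exp (-(b * y / v)) := by
      rw [← Real.exp_add]; congr 1; ring
    have e3 : Real.exp ((a - b) / v * y) = Real.exp (a * y / v) * Real.exp (-(b * y / v)) := by
      rw [← Real.exp_add]; congr 1; ring
    have e4 : Real.exp (-((a - b) / v) * y) =
        Real.exp (-(a * y / v)) * Real.exp (b * y / v) := by
      rw [← Real.exp_add]; congr 1; ring
    rw [e0, e1, e2, e3, e4, mixtureDensity, mixtureDensity, Real.cosh_eq, Real.cosh_eq]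
    ring
  have h1 := (hi ((a + b) / v)).fun_add (hi (-((a + b) / v)))
  have h2 := (hi ((a - b) / v)).fun_add (hi (-((a - b) / v)))
  rw [heq]
  refine ⟨(h1.fun_add h2).const_mul _, ?_⟩
  rw [integral_const_mul, integral_add h1 h2, integral_add (hi _) (hi _),
    integral_add (hi _) (hi _)]
  simp only [integral_exp_mul_gaussianReal]
  rw [Real.cosh_eq, neg_sq, neg_sq]
  have e1 : Real.exp (v * ((a + b) / v) ^ 2 / 2) =
      Real.exp ((a ^ 2 + b ^ 2) / (2 * v)) * Real.exp (a * b / v) := by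
    rw [← Real.exp_add]; congr 1; field_simp; ring
  have e2 : Real.exp (v * ((a - b) / v) ^ 2 / 2) =
      Real.exp ((a ^ 2 + b ^ 2) / (2 * v)) * Real.exp (-(a * b / v)) := by
    rw [← Real.exp_add]; congr 1; field_simp; ring
  have e3 : Real.exp (-(a ^ 2 + b ^ 2) / (2 * v)) * Real.exp ((a ^ 2 + b ^ 2) / (2 * v)) = 1 := by
    rw [← Real.exp_add, ← Real.exp_zero]; congr 1; ring
  rw [e1, e2]
  linear_combination (Real.exp (a * b / v) + Real.exp (-(a * b / v))) / 2 * e3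

lemma integrable_mixtureDensity {v : NNReal} (hv : v ≠ 0) (a : ℝ) :
    Integrable (mixtureDensity v a) (gaussianReal 0 v) ∧
    ∫ y, mixtureDensity v a y ∂gaussianReal 0 v = 1 := by
  have h0 : ∀ y, mixtureDensity v 0 y = 1 := fun y => by simp [mixtureDensity]
  simpa [h0] using integrable_mixtureDensity_mul hv a 0

/-- Joint convexity of (s, t) ↦ s²/t: the ratio for the mixtures is at most the average of the
ratios for the components, pairing a with b and -a with -b. -/
lemma mixtureDensity_sq_div_le_average (v a b y : ℝ) :
    mixtureDensity v a y ^ 2 / mixtureDensity v b y ≤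
      2⁻¹ * (Real.exp ((2 * a - b) / v * y - (2 * a ^ 2 - b ^ 2) / (2 * v)) +
        Real.exp (-((2 * a - b) / v) * y - (2 * a ^ 2 - b ^ 2) / (2 * v))) := by
  have titu : ∀ p q r s : ℝ, 0 < r → 0 < s → (p + q) ^ 2 / (r + s) ≤ p ^ 2 / r + q ^ 2 / s := by
    intro p q r s hr hs
    rw [div_add_div _ _ hr.ne' hs.ne', div_le_div_iff₀ (by positivity) (by positivity)]
    nlinarith [sq_nonneg (p * s - q * r)]
  have hsplit : ∀ c, mixtureDensity v c y =
      2⁻¹ * (Real.exp (c * y / v - c ^ 2 / (2 * v)) + Real.exp (-(c * y / v) - c ^ 2 / (2 * v))) := by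
    intro c
    rw [mixtureDensity, Real.cosh_eq, sub_eq_add_neg, sub_eq_add_neg, Real.exp_add, Real.exp_add,
      neg_div]
    ring
  have hdiv : ∀ s t : ℝ, Real.exp s ^ 2 / Real.exp t = Real.exp (2 * s - t) := by
    intro s t
    rw [Real.exp_sub, ← Real.exp_nat_mul]
    norm_cast
  have h := titu (Real.exp (a * y / v - a ^ 2 / (2 * v))) (Real.exp (-(a * y / v) - a ^ 2 / (2 * v)))
    (Real.exp (b * y / v - b ^ 2 / (2 * v))) (Real.exp (-(b * y / v) - b ^ 2 / (2 * v)))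
    (Real.exp_pos _) (Real.exp_pos _)
  rw [hdiv, hdiv] at h
  calc mixtureDensity v a y ^ 2 / mixtureDensity v b y
      = 2⁻¹ * ((Real.exp (a * y / v - a ^ 2 / (2 * v)) +
          Real.exp (-(a * y / v) - a ^ 2 / (2 * v))) ^ 2 /
          (Real.exp (b * y / v - b ^ 2 / (2 * v)) +
          Real.exp (-(b * y / v) - b ^ 2 / (2 * v)))) := by
        rw [hsplit, hsplit]
        field_simp
    _ ≤ _ := by
        refine mul_le_mul_of_nonneg_left (h.trans (le_of_eq ?_)) (by norm_num)
        congr 2 <;> ring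

lemma lintegral_mixtureDensity_sq_div_le_exp {v : NNReal} (hv : v ≠ 0) (a b : ℝ) :
    ∫⁻ y, ENNReal.ofReal (mixtureDensity v a y ^ 2 / mixtureDensity v b y) ∂gaussianReal 0 v ≤
      ENNReal.ofReal (Real.exp ((a - b) ^ 2 / v)) := by
  have hv' : (v : ℝ) ≠ 0 := by exact_mod_cast hv
  have hi : ∀ t s : ℝ, Integrable (fun y => Real.exp (t * y - s)) (gaussianReal 0 v) := by
    intro t s
    simp only [sub_eq_add_neg, Real.exp_add]
    exact (integrable_exp_mul_gaussianReal t).mul_const _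
  have hint : ∀ t s : ℝ,
      ∫ y, Real.exp (t * y - s) ∂gaussianReal 0 v = Real.exp (v * t ^ 2 / 2 - s) := by
    intro t s
    simp only [sub_eq_add_neg, Real.exp_add]
    rw [integral_mul_const, integral_exp_mul_gaussianReal]
  refine (lintegral_mono fun y =>
    ENNReal.ofReal_le_ofReal (mixtureDensity_sq_div_le_average v a b y)).trans ?_
  rw [← ofReal_integral_eq_lintegral_ofReal (((hi _ _).fun_add (hi _ _)).const_mul _)
    (.of_forall fun y => by positivity), integral_const_mul, integral_add (hi _ _) (hi _ _),
    hint, hint, neg_sq]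
  refine ENNReal.ofReal_le_ofReal (le_of_eq ?_)
  rw [← two_mul, inv_mul_cancel_left₀ two_ne_zero]
  congr 1
  field_simp
  ring

/-- Write f²/g = 2f - g + (f - g)²/g and use 1/g ≤ exp(b²/(2v)), valid since cosh ≥ 1. Only inner
products under the null law remain. Unlike the exponential bound, this one also detects that a and
-a give the same mixture. -/
lemma lintegral_mixtureDensity_sq_div_le_cosh {v : NNReal} (hv : v ≠ 0) (a b : ℝ) :
    ∫⁻ y, ENNReal.ofReal (mixtureDensity v a y ^ 2 / mixtureDensity v b y) ∂gaussianReal 0 v ≤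
      ENNReal.ofReal (1 + Real.exp (b ^ 2 / (2 * v)) *
        (Real.cosh (a * a / v) + Real.cosh (b * b / v) - 2 * Real.cosh (a * b / v))) := by
  have hpt : ∀ y, mixtureDensity v a y ^ 2 / mixtureDensity v b y ≤
      2 * mixtureDensity v a y - mixtureDensity v b y + Real.exp (b ^ 2 / (2 * v)) *
        (mixtureDensity v a y * mixtureDensity v a y + mixtureDensity v b y * mixtureDensity v b y
          - 2 * (mixtureDensity v a y * mixtureDensity v b y)) := by
    intro y
    have hb := mixtureDensity_pos v b y
    have hinv : 1 ≤ Real.exp (b ^ 2 / (2 * v)) * mixtureDensity v b y := by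
      rw [mixtureDensity, ← mul_assoc, ← Real.exp_add, neg_div, add_neg_cancel, Real.exp_zero,
        one_mul]
      exact Real.one_le_cosh _
    rw [div_le_iff₀ hb]
    nlinarith [mul_le_mul_of_nonneg_left hinv
      (sq_nonneg (mixtureDensity v a y - mixtureDensity v b y))]
  obtain ⟨ia, ea⟩ := integrable_mixtureDensity hv a
  obtain ⟨ib, eb⟩ := integrable_mixtureDensity hv b
  obtain ⟨iaa, eaa⟩ := integrable_mixtureDensity_mul hv a a
  obtain ⟨ibb, ebb⟩ := integrable_mixtureDensity_mul hv b b
  obtain ⟨iab, eab⟩ := integrable_mixtureDensity_mul hv a b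
  have i1 := (ia.const_mul 2).sub ib
  have i2 := (iaa.add ibb).sub (iab.const_mul 2)
  have i3 := i1.add (i2.const_mul (Real.exp (b ^ 2 / (2 * v))))
  refine (lintegral_mono fun y => ENNReal.ofReal_le_ofReal (hpt y)).trans ?_
  refine (ofReal_integral_eq_lintegral_ofReal i3 (.of_forall fun y => ?_)).symm.le.trans ?_
  · exact (div_nonneg (sq_nonneg _) (mixtureDensity_pos _ _ _).le).trans (hpt y)
  · refine ENNReal.ofReal_le_ofReal (le_of_eq ?_)
    rw [integral_add' i1 (i2.const_mul _), integral_sub' (ia.const_mul 2) ib, integral_const_mul,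
      integral_const_mul, integral_sub' (iaa.add ibb) (iab.const_mul 2), integral_add' iaa ibb,
      integral_const_mul, ea, eb, eaa, ebb, eab]
    ring

/-- The left side vanishes at a = b and at a = -b. Sum-to-product identities display this as sinh
factors in (a² - b²)/4 and (a ± b)²/4, to which sinh u ≤ u exp u applies. -/
lemma cosh_add_cosh_sub_le (a b : ℝ) :
    Real.cosh (a * a) + Real.cosh (b * b) - 2 * Real.cosh (a * b) ≤
      (a - b) ^ 2 * (a + b) ^ 2 / 2 * Real.exp (a ^ 2 + b ^ 2) := by
  have sinh_le : ∀ u : ℝ, 0 ≤ u → Real.sinh u ≤ u * Real.exp u := by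
    intro u hu
    rw [Real.sinh_eq]
    have h1 : Real.exp (-u) * Real.exp u = 1 := by rw [← Real.exp_add]; simp
    have h2 := Real.add_one_le_exp (-(2 * u))
    have h3 : Real.exp (-(2 * u)) * Real.exp u = Real.exp (-u) := by
      rw [← Real.exp_add]; congr 1; ring
    nlinarith [Real.exp_pos u]
  have cosh_sub : ∀ s t : ℝ, Real.cosh (s + t) - Real.cosh (s - t) =
      2 * (Real.sinh s * Real.sinh t) := by
    intro s t
    rw [Real.cosh_add, Real.cosh_sub]; ring
  have hAB : Real.cosh (a * a) + Real.cosh (b * b) - 2 * Real.cosh (a * b) =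
      4 * (Real.cosh ((a ^ 2 + b ^ 2) / 2) * Real.sinh (|a ^ 2 - b ^ 2| / 4) ^ 2) +
        4 * (Real.sinh ((a + b) ^ 2 / 4) * Real.sinh ((a - b) ^ 2 / 4)) := by
    have h1 := cosh_sub ((a + b) ^ 2 / 4) ((a - b) ^ 2 / 4)
    have e1 : (a + b) ^ 2 / 4 + (a - b) ^ 2 / 4 = (a ^ 2 + b ^ 2) / 2 := by ring
    have e2 : (a + b) ^ 2 / 4 - (a - b) ^ 2 / 4 = a * b := by ring
    rw [e1, e2] at h1
    have h2 : Real.sinh (|a ^ 2 - b ^ 2| / 4) ^ 2 = Real.sinh ((a ^ 2 - b ^ 2) / 4) ^ 2 := by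
      rcases abs_cases (a ^ 2 - b ^ 2) with ⟨h, -⟩ | ⟨h, -⟩ <;> rw [h]
      rw [neg_div, Real.sinh_neg, neg_sq]
    have h3 : Real.cosh (a * a) + Real.cosh (b * b) =
        2 * Real.cosh ((a ^ 2 + b ^ 2) / 2) * Real.cosh ((a ^ 2 - b ^ 2) / 2) := by
      have e3 : a * a = (a ^ 2 + b ^ 2) / 2 + (a ^ 2 - b ^ 2) / 2 := by ring
      have e4 : b * b = (a ^ 2 + b ^ 2) / 2 - (a ^ 2 - b ^ 2) / 2 := by ring
      rw [e3, e4, Real.cosh_add, Real.cosh_sub]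
      ring
    have h4 : Real.cosh ((a ^ 2 - b ^ 2) / 2) = 1 + 2 * Real.sinh ((a ^ 2 - b ^ 2) / 4) ^ 2 := by
      have e5 : (a ^ 2 - b ^ 2) / 2 = 2 * ((a ^ 2 - b ^ 2) / 4) := by ring
      rw [e5, Real.cosh_two_mul, Real.cosh_sq]
      ring
    rw [h2, h3, h4]
    linarith
  have hd : |a ^ 2 - b ^ 2| ≤ a ^ 2 + b ^ 2 := by
    rw [abs_le]; constructor <;> nlinarith [sq_nonneg a, sq_nonneg b]
  have hc : Real.cosh ((a ^ 2 + b ^ 2) / 2) ≤ Real.exp ((a ^ 2 + b ^ 2) / 2) := by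
    rw [Real.cosh_eq]
    have : Real.exp (-((a ^ 2 + b ^ 2) / 2)) ≤ Real.exp ((a ^ 2 + b ^ 2) / 2) :=
      Real.exp_le_exp.2 (by nlinarith [sq_nonneg a, sq_nonneg b])
    linarith
  have hs1 : Real.sinh (|a ^ 2 - b ^ 2| / 4) ^ 2 ≤
      (|a ^ 2 - b ^ 2| / 4 * Real.exp (|a ^ 2 - b ^ 2| / 4)) ^ 2 :=
    pow_le_pow_left₀ (Real.sinh_nonneg_iff.2 (by positivity)) (sinh_le _ (by positivity)) 2
  have hs2 : Real.sinh ((a + b) ^ 2 / 4) * Real.sinh ((a - b) ^ 2 / 4) ≤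
      ((a + b) ^ 2 / 4 * Real.exp ((a + b) ^ 2 / 4)) *
        ((a - b) ^ 2 / 4 * Real.exp ((a - b) ^ 2 / 4)) :=
    mul_le_mul (sinh_le _ (by positivity)) (sinh_le _ (by positivity))
      (Real.sinh_nonneg_iff.2 (by positivity)) (by positivity)
  have t1 : Real.cosh ((a ^ 2 + b ^ 2) / 2) * Real.sinh (|a ^ 2 - b ^ 2| / 4) ^ 2 ≤
      (a - b) ^ 2 * (a + b) ^ 2 / 16 * Real.exp (a ^ 2 + b ^ 2) := by
    calc _ ≤ Real.exp ((a ^ 2 + b ^ 2) / 2) *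
          (|a ^ 2 - b ^ 2| / 4 * Real.exp (|a ^ 2 - b ^ 2| / 4)) ^ 2 :=
          mul_le_mul hc hs1 (sq_nonneg _) (Real.exp_pos _).le
      _ = (a - b) ^ 2 * (a + b) ^ 2 / 16 *
          Real.exp ((a ^ 2 + b ^ 2) / 2 + |a ^ 2 - b ^ 2| / 2) := by
          have e6 : Real.exp (|a ^ 2 - b ^ 2| / 2) = Real.exp (|a ^ 2 - b ^ 2| / 4) ^ 2 := by
            rw [← Real.exp_nat_mul]; congr 1; push_cast; ring
          rw [Real.exp_add, e6, mul_pow, div_pow, sq_abs]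
          ring
      _ ≤ _ := by
          refine mul_le_mul_of_nonneg_left (Real.exp_le_exp.2 ?_) (by positivity)
          linarith
  have t2 : Real.sinh ((a + b) ^ 2 / 4) * Real.sinh ((a - b) ^ 2 / 4) ≤
      (a - b) ^ 2 * (a + b) ^ 2 / 16 * Real.exp (a ^ 2 + b ^ 2) := by
    refine hs2.trans ?_
    calc _ = (a - b) ^ 2 * (a + b) ^ 2 / 16 *
          Real.exp ((a + b) ^ 2 / 4 + (a - b) ^ 2 / 4) := by
          rw [Real.exp_add]; ring
      _ ≤ _ := by
          refine mul_le_mul_of_nonneg_left (Real.exp_le_exp.2 ?_) (by positivity)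
          nlinarith [sq_nonneg a, sq_nonneg b]
  rw [hAB]
  linarith

/-! ### Averaging over a Gaussian covariate -/

lemma map_sum_mul_pi_gaussianReal {p : ℕ} (u : EuclideanSpace ℝ (Fin p)) (hu : ‖u‖ = 1) :
    (Measure.pi fun _ : Fin p => gaussianReal 0 1).map (fun x => ∑ j, x j * u j) =
      gaussianReal 0 1 := by
  have h := IsGaussian.map_eq_gaussianReal (μ := stdGaussian (EuclideanSpace ℝ (Fin p)))
    (innerSL ℝ u)
  rw [integral_strongDual_stdGaussian, variance_dual_stdGaussian, innerSL_apply_norm, hu,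
    ← map_pi_eq_stdGaussian, Measure.map_map (by fun_prop) (by fun_prop)] at h
  simpa [Function.comp_def, PiLp.inner_apply] using h

/-- A finite bound on all Gaussian moments used below. -/
noncomputable def momentBound : ℝ≥0∞ :=
  ∫⁻ g, ENNReal.ofReal (1 + (g ^ 2 * Real.exp (g ^ 2 / 8)) ^ 2) ∂gaussianReal 0 1

/-- The square grows like g⁴ exp(g²/4), and g⁴ costs a further exp(g²/8); the Gaussian weight
exp(-g²/2) still leaves exp(-g²/8). -/
lemma momentBound_ne_top : momentBound ≠ ∞ := by
  rw [momentBound, gaussianReal_of_var_ne_zero _ one_ne_zero,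
    lintegral_withDensity_eq_lintegral_mul _ (measurable_gaussianPDF _ _) (by fun_prop)]
  have hint : Integrable fun g : ℝ => 129 * Real.exp (-(1 / 8) * g ^ 2) :=
    (integrable_exp_neg_mul_sq (by norm_num)).const_mul _
  refine ne_top_of_le_ne_top hint.lintegral_lt_top.ne (lintegral_mono fun g => ?_)
  rw [Pi.mul_apply, gaussianPDF, ← ENNReal.ofReal_mul (gaussianPDFReal_nonneg _ _ _)]
  refine ENNReal.ofReal_le_ofReal ?_
  have hpdf : gaussianPDFReal 0 1 g ≤ Real.exp (-(g ^ 2 / 2)) := by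
    rw [gaussianPDFReal]
    have h1 : (√(2 * Real.pi * (1 : NNReal)))⁻¹ ≤ 1 := by
      refine inv_le_one_of_one_le₀ (Real.one_le_sqrt.2 ?_)
      have := Real.pi_gt_three
      push_cast
      linarith
    calc _ ≤ 1 * Real.exp (-(g - 0) ^ 2 / (2 * (1 : NNReal))) :=
          mul_le_mul_of_nonneg_right h1 (Real.exp_pos _).le
      _ = _ := by rw [one_mul]; congr 1; push_cast; ring
  have hq := Real.quadratic_le_exp_of_nonneg (x := g ^ 2 / 8) (by positivity)
  -- The quadratic Taylor term of exp at g²/8 is g⁴/128.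
  have hpoly : g ^ 4 ≤ 128 * Real.exp (g ^ 2 / 8) := by nlinarith [sq_nonneg g]
  have hone : 1 ≤ Real.exp (g ^ 2 / 8) := Real.one_le_exp (by positivity)
  have hone' : 1 ≤ Real.exp (g ^ 2 / 4) := Real.one_le_exp (by positivity)
  have hsq : Real.exp (g ^ 2 / 8) ^ 2 = Real.exp (g ^ 2 / 4) := by
    rw [← Real.exp_nat_mul]; congr 1; push_cast; ring
  have hmain : 1 + (g ^ 2 * Real.exp (g ^ 2 / 8)) ^ 2 ≤
      129 * (Real.exp (g ^ 2 / 8) * Real.exp (g ^ 2 / 4)) := by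
    rw [mul_pow, hsq, ← pow_mul]
    nlinarith [mul_le_mul_of_nonneg_right hpoly (Real.exp_pos (g ^ 2 / 4)).le,
      one_le_mul_of_one_le_of_one_le hone hone']
  calc _ ≤ Real.exp (-(g ^ 2 / 2)) * (129 * (Real.exp (g ^ 2 / 8) * Real.exp (g ^ 2 / 4))) :=
        mul_le_mul hpdf hmain (by positivity) (Real.exp_pos _).le
    _ = _ := by
        rw [mul_left_comm, ← Real.exp_add, ← Real.exp_add]
        congr 2
        ring

lemma lintegral_pi_gaussianReal_comp {p : ℕ} {w : EuclideanSpace ℝ (Fin p)} (hw : w ≠ 0) :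
    ∫⁻ x, ENNReal.ofReal (1 + ((∑ j, x j * (‖w‖⁻¹ • w) j) ^ 2 *
        Real.exp ((∑ j, x j * (‖w‖⁻¹ • w) j) ^ 2 / 8)) ^ 2)
      ∂(Measure.pi fun _ : Fin p => gaussianReal 0 1) = momentBound := by
  have hu : ‖‖w‖⁻¹ • w‖ = 1 := norm_smul_inv_norm (𝕜 := ℝ) hw
  rw [momentBound]
  conv_rhs => rw [← map_sum_mul_pi_gaussianReal _ hu]
  rw [lintegral_map (by fun_prop) (by fun_prop)]

lemma sum_mul_eq_norm_mul {p : ℕ} {w : EuclideanSpace ℝ (Fin p)} (hw : w ≠ 0) (x : Fin p → ℝ) :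
    ∑ j, x j * w j = ‖w‖ * ∑ j, x j * (‖w‖⁻¹ • w) j := by
  have : ‖w‖ ≠ 0 := norm_ne_zero_iff.2 hw
  rw [Finset.mul_sum]
  refine Finset.sum_congr rfl fun j _ => ?_
  rw [PiLp.smul_apply, smul_eq_mul]
  field_simp

/-- The second moment of the one-observation likelihood ratio between `(β, -β)` and `(β', -β')`. -/
noncomputable def likelihoodMoment {p : ℕ} (v : NNReal) (β β' : EuclideanSpace ℝ (Fin p)) : ℝ≥0∞ :=
  ∫⁻ x, ∫⁻ y, ENNReal.ofReal (mixtureDensity v (∑ j, x j * β j) y ^ 2 /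
      mixtureDensity v (∑ j, x j * β' j) y) ∂gaussianReal 0 v
    ∂(Measure.pi fun _ : Fin p => gaussianReal 0 1)

lemma lintegral_one_add_le {p : ℕ} {F G : (Fin p → ℝ) → ℝ} {c : ℝ} (hc : 0 ≤ c)
    (hG : ∀ x, 0 ≤ G x) (hGm : Measurable G) (h : ∀ x, F x ≤ 1 + c * G x) :
    ∫⁻ x, ENNReal.ofReal (F x) ∂(Measure.pi fun _ : Fin p => gaussianReal 0 1) ≤
      1 + ENNReal.ofReal c *
        ∫⁻ x, ENNReal.ofReal (G x) ∂(Measure.pi fun _ : Fin p => gaussianReal 0 1) := by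
  calc _ ≤ ∫⁻ x, 1 + ENNReal.ofReal c * ENNReal.ofReal (G x)
        ∂(Measure.pi fun _ : Fin p => gaussianReal 0 1) := by
        refine lintegral_mono fun x => ?_
        rw [← ENNReal.ofReal_mul hc, ← ENNReal.ofReal_one,
          ← ENNReal.ofReal_add zero_le_one (mul_nonneg hc (hG x))]
        exact ENNReal.ofReal_le_ofReal (h x)
    _ = _ := by
        rw [lintegral_add_left measurable_const, lintegral_const, measure_univ, mul_one,
          lintegral_const_mul _ (by fun_prop)]

/-- Here s is the norm of β ± β' and g the normalized projection. The bound s² ≤ v/8 caps the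
exponent at g²/8, so that even the square is Gaussian-integrable. -/
lemma sq_mul_exp_le {v s g : ℝ} (hv : 0 < v) (hs : s ^ 2 ≤ v / 8) :
    (s * g) ^ 2 / v * Real.exp ((s * g) ^ 2 / v) ≤
      s ^ 2 / v * (g ^ 2 * Real.exp (g ^ 2 / 8)) := by
  have h : (s * g) ^ 2 / v ≤ g ^ 2 / 8 := by
    rw [div_le_iff₀ hv, mul_pow]
    nlinarith [mul_le_mul_of_nonneg_right hs (sq_nonneg g)]
  calc _ = s ^ 2 / v * (g ^ 2 * Real.exp ((s * g) ^ 2 / v)) := by ring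
    _ ≤ _ := by gcongr

lemma likelihoodMoment_le_of_norm_sub {p : ℕ} {v : NNReal} (hv : v ≠ 0)
    {β β' : EuclideanSpace ℝ (Fin p)} (hne : β ≠ β') (hsub : ‖β - β'‖ ^ 2 ≤ v / 8) :
    likelihoodMoment v β β' ≤ 1 + ENNReal.ofReal (‖β - β'‖ ^ 2 / v) * momentBound := by
  have hv' : 0 < (v : ℝ) := by exact_mod_cast pos_iff_ne_zero.2 hv
  have hw := sub_ne_zero.2 hne
  rw [← lintegral_pi_gaussianReal_comp hw]
  refine (lintegral_mono fun x => lintegral_mixtureDensity_sq_div_le_exp hv _ _).trans ?_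
  refine lintegral_one_add_le (by positivity) (fun x => by positivity) (by fun_prop) fun x => ?_
  have hd : ∑ j, x j * β j - ∑ j, x j * β' j = ∑ j, x j * (β - β') j := by
    rw [← Finset.sum_sub_distrib]
    exact Finset.sum_congr rfl fun j _ => by rw [PiLp.sub_apply]; ring
  rw [hd, sum_mul_eq_norm_mul hw]
  generalize ∑ j, x j * (‖β - β'‖⁻¹ • (β - β')) j = g
  have h1 := sq_mul_exp_le (g := g) hv' hsub
  have h2 : ∀ t : ℝ, Real.exp t ≤ 1 + t * Real.exp t := by
    intro t
    have h3 := Real.add_one_le_exp (-t)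
    have h4 : Real.exp (-t) * Real.exp t = 1 := by rw [← Real.exp_add]; simp
    nlinarith [Real.exp_pos t]
  refine (h2 _).trans (by
    gcongr 1 + ?_
    refine h1.trans ?_
    gcongr
    -- With T = g² exp(g²/8), this is T ≤ 1 + T², the integrand of `momentBound`.
    nlinarith [sq_nonneg (g ^ 2 * Real.exp (g ^ 2 / 8) - 1)])

/-- The cosh bound produces a product of functions of the projections on β - β' and β + β'.
Splitting it into squares by AM-GM leaves one-dimensional moments, so no independence of the two
projections is needed. -/
lemma likelihoodMoment_le_of_norm_add {p : ℕ} {v : NNReal} (hv : v ≠ 0)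
    {β β' : EuclideanSpace ℝ (Fin p)} (hne : β ≠ β') (hne' : β + β' ≠ 0)
    (hsub : ‖β - β'‖ ^ 2 ≤ v / 8) (hadd : ‖β + β'‖ ^ 2 ≤ v / 8) :
    likelihoodMoment v β β' ≤
      1 + ENNReal.ofReal (‖β - β'‖ ^ 2 / v * (‖β + β'‖ ^ 2 / v)) * momentBound := by
  have hv' : 0 < (v : ℝ) := by exact_mod_cast pos_iff_ne_zero.2 hv
  have hw := sub_ne_zero.2 hne
  set c := ‖β - β'‖ ^ 2 / v * (‖β + β'‖ ^ 2 / v) with hc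
  have hc0 : 0 ≤ c := by positivity
  set G : EuclideanSpace ℝ (Fin p) → (Fin p → ℝ) → ℝ := fun w x =>
    1 + ((∑ j, x j * (‖w‖⁻¹ • w) j) ^ 2 * Real.exp ((∑ j, x j * (‖w‖⁻¹ • w) j) ^ 2 / 8)) ^ 2
    with hG
  have hGm : ∀ w, Measurable (G w) := fun w => by rw [hG]; fun_prop
  have hG0 : ∀ w x, 0 ≤ G w x := fun w x => by rw [hG]; positivity
  have hmoment : ∀ w, w ≠ 0 → ∫⁻ x, ENNReal.ofReal (G w x)
      ∂(Measure.pi fun _ : Fin p => gaussianReal 0 1) = momentBound :=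
    fun w hw => lintegral_pi_gaussianReal_comp hw
  have havg : ∫⁻ x, ENNReal.ofReal ((G (β - β') x + G (β + β') x) / 2)
      ∂(Measure.pi fun _ : Fin p => gaussianReal 0 1) = momentBound := by
    have : ∀ x, ENNReal.ofReal ((G (β - β') x + G (β + β') x) / 2) =
        2⁻¹ * (ENNReal.ofReal (G (β - β') x) + ENNReal.ofReal (G (β + β') x)) := by
      intro x
      rw [← ENNReal.ofReal_add (hG0 _ _) (hG0 _ _), div_eq_inv_mul,
        ENNReal.ofReal_mul (by norm_num), ENNReal.ofReal_inv_of_pos (by norm_num)]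
      norm_num
    simp_rw [this]
    rw [lintegral_const_mul _ (by fun_prop), lintegral_add_left (by fun_prop), hmoment _ hw,
      hmoment _ hne', ← two_mul, ← mul_assoc, ENNReal.inv_mul_cancel (by norm_num) (by norm_num),
      one_mul]
  rw [← havg]
  refine (lintegral_mono fun x => lintegral_mixtureDensity_sq_div_le_cosh hv _ _).trans ?_
  refine lintegral_one_add_le hc0 (fun x => div_nonneg (add_nonneg (hG0 _ _) (hG0 _ _)) zero_le_two)
    (((hGm _).add (hGm _)).div_const _) fun x => ?_
  gcongr 1 + ?_
  have hd : ∑ j, x j * (β - β') j = ∑ j, x j * β j - ∑ j, x j * β' j := by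
    rw [← Finset.sum_sub_distrib]
    exact Finset.sum_congr rfl fun j _ => by rw [PiLp.sub_apply]; ring
  have ha : ∑ j, x j * (β + β') j = ∑ j, x j * β j + ∑ j, x j * β' j := by
    rw [← Finset.sum_add_distrib]
    exact Finset.sum_congr rfl fun j _ => by rw [PiLp.add_apply]; ring
  rw [sum_mul_eq_norm_mul hw] at hd
  rw [sum_mul_eq_norm_mul hne'] at ha
  simp only [hG]
  generalize ∑ j, x j * (‖β - β'‖⁻¹ • (β - β')) j = g at hd ⊢
  generalize ∑ j, x j * (‖β + β'‖⁻¹ • (β + β')) j = k at ha ⊢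
  generalize ∑ j, x j * β j = a at hd ha ⊢
  generalize ∑ j, x j * β' j = b at hd ha ⊢
  have hg := sq_mul_exp_le (g := g) hv' hsub
  have hk := sq_mul_exp_le (g := k) hv' hadd
  rw [hd] at hg
  rw [ha] at hk
  have hr : √(v : ℝ) ^ 2 = v := Real.sq_sqrt hv'.le
  have hr0 : √(v : ℝ) ≠ 0 := (Real.sqrt_pos.2 hv').ne'
  have hcosh := cosh_add_cosh_sub_le (a / √(v : ℝ)) (b / √(v : ℝ))
  simp only [div_mul_div_comm, ← pow_two, hr, ← sub_div, ← add_div, div_pow] at hcosh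
  simp only [← pow_two]
  calc _ ≤ Real.exp (b ^ 2 / (2 * v)) *
        ((a - b) ^ 2 / v * ((a + b) ^ 2 / v) / 2 * Real.exp ((a ^ 2 + b ^ 2) / v)) := by
        gcongr
        rw [div_mul_div_comm, ← pow_two (v : ℝ)]
        exact hcosh
    _ ≤ ((a - b) ^ 2 / v * Real.exp ((a - b) ^ 2 / v)) *
          ((a + b) ^ 2 / v * Real.exp ((a + b) ^ 2 / v)) / 2 := by
        -- The exponents on the right add up to 2(a² + b²)/v, which absorbs both exponentials on the
        -- left.
        have : Real.exp (b ^ 2 / (2 * v)) * Real.exp ((a ^ 2 + b ^ 2) / v) ≤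
            Real.exp ((a - b) ^ 2 / v) * Real.exp ((a + b) ^ 2 / v) := by
          rw [← Real.exp_add, ← Real.exp_add, Real.exp_le_exp, ← sub_nonneg]
          have : (a - b) ^ 2 / v + (a + b) ^ 2 / v - (b ^ 2 / (2 * v) + (a ^ 2 + b ^ 2) / v) =
              (a ^ 2 + b ^ 2 / 2) / v := by field_simp; ring
          rw [this]
          positivity
        calc _ = (a - b) ^ 2 / v * ((a + b) ^ 2 / v) / 2 *
              (Real.exp (b ^ 2 / (2 * v)) * Real.exp ((a ^ 2 + b ^ 2) / v)) := by ring
          _ ≤ (a - b) ^ 2 / v * ((a + b) ^ 2 / v) / 2 *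
              (Real.exp ((a - b) ^ 2 / v) * Real.exp ((a + b) ^ 2 / v)) := by gcongr
          _ = _ := by ring
    _ ≤ (‖β - β'‖ ^ 2 / v * (g ^ 2 * Real.exp (g ^ 2 / 8))) *
          (‖β + β'‖ ^ 2 / v * (k ^ 2 * Real.exp (k ^ 2 / 8))) / 2 := by
        gcongr ?_ / 2
        exact mul_le_mul hg hk (by positivity) (by positivity)
    _ = c * ((g ^ 2 * Real.exp (g ^ 2 / 8)) * (k ^ 2 * Real.exp (k ^ 2 / 8)) / 2) := by
        rw [hc]; ring
    _ ≤ _ := by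
        refine mul_le_mul_of_nonneg_left ?_ hc0
        nlinarith [sq_nonneg (g ^ 2 * Real.exp (g ^ 2 / 8) - k ^ 2 * Real.exp (k ^ 2 / 8)),
          sq_nonneg (g ^ 2 * Real.exp (g ^ 2 / 8) + k ^ 2 * Real.exp (k ^ 2 / 8))]

/-! ### The law of n observations and tensorization -/

lemma lintegral_prod_pi {ι α : Type*} [Fintype ι] [MeasurableSpace α] (μ : Measure α)
    [IsProbabilityMeasure μ] {f : ι → α → ℝ≥0∞} (hf : ∀ i, Measurable (f i)) :
    ∫⁻ x, ∏ i, f i (x i) ∂(Measure.pi fun _ : ι => μ) = ∏ i, ∫⁻ x, f i x ∂μ := by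
  have hind : iIndepFun (fun i (x : ι → α) => f i (x i)) (Measure.pi fun _ : ι => μ) :=
    iIndepFun_pi fun i => (hf i).aemeasurable
  rw [lintegral_prod_eq_prod_lintegral_of_indepFun Finset.univ (fun i (x : ι → α) => f i (x i))
    hind fun i => (hf i).comp (measurable_pi_apply i)]
  refine Finset.prod_congr rfl fun i _ => ?_
  exact (measurePreserving_eval (fun _ : ι => μ) i).lintegral_comp (hf i)

lemma pi_withDensity {ι α : Type*} [Fintype ι] [MeasurableSpace α] (μ : Measure α)
    [IsProbabilityMeasure μ] {f : ι → α → ℝ≥0∞} (hf : ∀ i, Measurable (f i))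
    [∀ i, SigmaFinite (μ.withDensity (f i))] :
    Measure.pi (fun i => μ.withDensity (f i)) =
      (Measure.pi fun _ : ι => μ).withDensity fun x => ∏ i, f i (x i) := by
  classical
  refine Measure.pi_eq fun s hs => ?_
  rw [withDensity_apply _ (.univ_pi hs), ← lintegral_indicator (.univ_pi hs)]
  have : ∀ x : ι → α, (Set.univ.pi s).indicator (fun x => ∏ i, f i (x i)) x =
      ∏ i, (s i).indicator (f i) (x i) := by
    intro x
    by_cases hx : x ∈ Set.univ.pi s
    · rw [Set.indicator_of_mem hx]
      exact Finset.prod_congr rfl fun i _ => (Set.indicator_of_mem (hx i trivial) _).symm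
    · rw [Set.indicator_of_notMem hx]
      obtain ⟨i, hi⟩ : ∃ i, x i ∉ s i := by simpa [Set.mem_pi] using hx
      exact (Finset.prod_eq_zero (Finset.mem_univ i) (Set.indicator_of_notMem hi _)).symm
  simp_rw [this]
  rw [lintegral_prod_pi μ fun i => (hf i).indicator (hs i)]
  refine Finset.prod_congr rfl fun i _ => ?_
  rw [lintegral_indicator (hs i), withDensity_apply _ (hs i)]

lemma measurable_observe {n p : ℕ} (θ : Regressors p) :
    Measurable (observe θ : Sample n p → Data n p) := by
  refine measurable_fst.prodMk (measurable_pi_lambda _ fun i => ?_)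
  refine Measurable.add (Finset.measurable_sum _ fun j _ => Measurable.mul (by fun_prop) ?_)
    (by fun_prop)
  exact (measurable_of_finite fun k : Fin 2 => if k = 1 then θ.1 j else θ.2 j).comp
    ((measurable_pi_apply i).comp (measurable_fst.comp measurable_snd))

instance (n p : ℕ) (σ : ℝ) : IsProbabilityMeasure (sampleLaw n p σ) := by
  unfold sampleLaw
  infer_instance

/-- The density of the responses `y` given the design `X`, under the parameter `(β, -β)`. -/
noncomputable def likelihood {n p : ℕ} (v : NNReal) (β : EuclideanSpace ℝ (Fin p))
    (q : Data n p) : ℝ :=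
  ∏ i, mixtureDensity v (∑ j, q.1 i j * β j) (q.2 i)

lemma likelihood_pos {n p : ℕ} (v : NNReal) (β : EuclideanSpace ℝ (Fin p)) (q : Data n p) :
    0 < likelihood v β q :=
  Finset.prod_pos fun _ _ => mixtureDensity_pos _ _ _

lemma measurable_likelihood {n p : ℕ} (v : NNReal) (β : EuclideanSpace ℝ (Fin p)) :
    Measurable (likelihood v β : Data n p → ℝ) := by
  unfold likelihood mixtureDensity
  fun_prop

lemma measurable_mixtureDensity (v a : ℝ) : Measurable (mixtureDensity v a) := by
  unfold mixtureDensity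
  fun_prop

/-- The dominating law: design and responses independent. -/
noncomputable def nullLaw (n p : ℕ) (v : NNReal) : Measure (Data n p) :=
  (Measure.pi fun _ : Fin n => Measure.pi fun _ : Fin p => gaussianReal 0 1).prod
    (Measure.pi fun _ : Fin n => gaussianReal 0 v)

lemma map_observe_neg {n p : ℕ} {σ : ℝ} (hσ : 0 < σ) (β : EuclideanSpace ℝ (Fin p)) :
    (sampleLaw n p σ).map (observe (β, -β)) =
      (nullLaw n p (Real.toNNReal (σ ^ 2))).withDensity
        fun q => ENNReal.ofReal (likelihood (Real.toNNReal (σ ^ 2)) β q) := by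
  set v := Real.toNNReal (σ ^ 2) with hvdef
  have hv : v ≠ 0 := (Real.toNNReal_pos.2 (by positivity)).ne'
  have hlik := (measurable_likelihood (n := n) v β).ennreal_ofReal
  -- Given the design, the pairs (zᵢ, eᵢ) are independent, so the responses form a product of scalar
  -- mixtures; integrating over X by Fubini then gives the joint density.
  have hcond : ∀ X : Design n p,
      ((Measure.pi fun _ : Fin n => labelLaw).prod
        (Measure.pi fun _ : Fin n => gaussianReal 0 v)).map
          (fun w i => (if w.1 i = 1 then ∑ j, X i j * β j else -∑ j, X i j * β j) + w.2 i) =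
      (Measure.pi fun _ : Fin n => gaussianReal 0 v).withDensity
        fun y => ENNReal.ofReal (likelihood v β (X, y)) := by
    intro X
    have hm : ∀ i, Measurable fun q : Fin 2 × ℝ =>
        (if q.1 = 1 then ∑ j, X i j * β j else -∑ j, X i j * β j) + q.2 := fun i =>
      Measurable.add ((measurable_of_finite fun k : Fin 2 =>
        if k = 1 then ∑ j, X i j * β j else -∑ j, X i j * β j).comp measurable_fst) measurable_snd
    have hprob : ∀ i, IsProbabilityMeasure ((gaussianReal 0 v).withDensity
        fun y => ENNReal.ofReal (mixtureDensity v (∑ j, X i j * β j) y)) := by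
      intro i
      rw [← map_label_noise hv]
      exact Measure.isProbabilityMeasure_map (hm i).aemeasurable
    have hsf : ∀ i, SigmaFinite ((labelLaw.prod (gaussianReal 0 v)).map fun q =>
        (if q.1 = 1 then ∑ j, X i j * β j else -∑ j, X i j * β j) + q.2) := by
      intro i
      rw [map_label_noise hv]
      infer_instance
    rw [← (measurePreserving_arrowProdEquivProdArrow (Fin 2) ℝ (Fin n) (fun _ => labelLaw)
      (fun _ => gaussianReal 0 v)).map_eq, Measure.map_map _ (MeasurableEquiv.measurable _)]
    · refine (Measure.pi_map_pi (μ := fun _ : Fin n => labelLaw.prod (gaussianReal 0 v))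
        fun i => (hm i).aemeasurable).trans ?_
      simp_rw [map_label_noise hv]
      rw [pi_withDensity _ fun i => (measurable_mixtureDensity _ _).ennreal_ofReal]
      congr 1
      ext y
      rw [likelihood, ENNReal.ofReal_prod_of_nonneg fun i _ => (mixtureDensity_pos _ _ _).le]
    · have hcoord : ∀ i, Measurable fun w : (Fin n → Fin 2) × (Fin n → ℝ) => (w.1 i, w.2 i) :=
        fun i => by fun_prop
      exact measurable_pi_lambda _ fun i => (hm i).comp (hcoord i)
  ext A hA
  rw [Measure.map_apply (measurable_observe _) hA, withDensity_apply _ hA,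
    ← lintegral_indicator hA, sampleLaw, nullLaw,
    Measure.prod_apply (measurable_observe _ hA),
    lintegral_prod _ (hlik.indicator hA).aemeasurable]
  refine lintegral_congr fun X => ?_
  have hAX : MeasurableSet (Prod.mk X ⁻¹' A) := measurable_prodMk_left hA
  have h := congrArg (fun μ => μ (Prod.mk X ⁻¹' A)) (hcond X)
  simp only at h
  rw [withDensity_apply _ hAX, ← lintegral_indicator hAX, Measure.map_apply _ hAX] at h
  · refine Eq.trans (congrArg _ ?_) h
    ext w
    simp only [Set.mem_preimage, observe]
    congr! 3 with i
    split_ifs <;> simp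
  · refine measurable_pi_lambda _ fun i => Measurable.add ?_ (by fun_prop)
    exact (measurable_of_finite fun k : Fin 2 =>
        if k = 1 then ∑ j, X i j * β j else -∑ j, X i j * β j).comp
      ((measurable_pi_apply i).comp measurable_fst)

lemma lintegral_likelihood_sq_div {n p : ℕ} (v : NNReal) (β β' : EuclideanSpace ℝ (Fin p)) :
    ∫⁻ q, ENNReal.ofReal (likelihood v β q ^ 2 / likelihood v β' q) ∂nullLaw n p v =
      likelihoodMoment v β β' ^ n := by
  have hm : Measurable fun q : (Fin p → ℝ) × ℝ =>
      ENNReal.ofReal (mixtureDensity v (∑ j, q.1 j * β j) q.2 ^ 2 /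
        mixtureDensity v (∑ j, q.1 j * β' j) q.2) := by
    unfold mixtureDensity
    fun_prop
  have hprod : ∀ q : Data n p, ENNReal.ofReal (likelihood v β q ^ 2 / likelihood v β' q) =
      ∏ i, ENNReal.ofReal (mixtureDensity v (∑ j, q.1 i j * β j) (q.2 i) ^ 2 /
        mixtureDensity v (∑ j, q.1 i j * β' j) (q.2 i)) := by
    intro q
    rw [likelihood, likelihood, ← Finset.prod_pow, ← Finset.prod_div_distrib,
      ENNReal.ofReal_prod_of_nonneg]
    exact fun i _ => div_nonneg (sq_nonneg _) (mixtureDensity_pos _ _ _).le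
  have hratio : Measurable fun q : Data n p => likelihood v β q ^ 2 / likelihood v β' q :=
    ((measurable_likelihood v β).pow_const 2).div (measurable_likelihood v β')
  rw [nullLaw, lintegral_prod _ hratio.ennreal_ofReal.aemeasurable]
  simp_rw [hprod]
  have hinner : ∀ X : Design n p, ∫⁻ y : Fin n → ℝ,
      ∏ i, ENNReal.ofReal (mixtureDensity v (∑ j, X i j * β j) (y i) ^ 2 /
        mixtureDensity v (∑ j, X i j * β' j) (y i)) ∂(Measure.pi fun _ => gaussianReal 0 v) =
      ∏ i, ∫⁻ y, ENNReal.ofReal (mixtureDensity v (∑ j, X i j * β j) y ^ 2 /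
        mixtureDensity v (∑ j, X i j * β' j) y) ∂gaussianReal 0 v := fun X =>
    lintegral_prod_pi (gaussianReal 0 v)
      (f := fun i y => ENNReal.ofReal (mixtureDensity v (∑ j, X i j * β j) y ^ 2 /
        mixtureDensity v (∑ j, X i j * β' j) y))
      fun i => (((measurable_mixtureDensity _ _).pow_const 2).div
        (measurable_mixtureDensity _ _)).ennreal_ofReal
  simp_rw [hinner]
  rw [lintegral_prod_pi (Measure.pi fun _ : Fin p => gaussianReal 0 1)
    (f := fun _ x => ∫⁻ y, ENNReal.ofReal (mixtureDensity v (∑ j, x j * β j) y ^ 2 /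
        mixtureDensity v (∑ j, x j * β' j) y) ∂gaussianReal 0 v)
    fun _ => hm.lintegral_prod_right', Finset.prod_const, Finset.card_univ, Fintype.card_fin,
    likelihoodMoment]

/-! ### Testing two parameters -/

/-- Le Cam's two-point bound, in terms of the second moment of the likelihood ratio. -/
lemma half_le_withDensity_add_compl {α : Type*} [MeasurableSpace α] {μ : Measure α}
    {f g : α → ℝ} (hf : Measurable f) (hg : Measurable g) (hf0 : ∀ x, 0 ≤ f x)
    (hg0 : ∀ x, 0 < g x) (hf1 : ∫⁻ x, ENNReal.ofReal (f x) ∂μ = 1)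
    (hfg : ∫⁻ x, ENNReal.ofReal (f x ^ 2 / g x) ∂μ ≤ 2) {A : Set α} (hA : MeasurableSet A) :
    2⁻¹ ≤ μ.withDensity (fun x => ENNReal.ofReal (f x)) A +
      μ.withDensity (fun x => ENNReal.ofReal (g x)) Aᶜ := by
  -- For g ≤ f this is (f - 2g)² ≥ 0. With weight 1/4, a second moment of at most 2 costs at most
  -- half of the mass of f.
  have hpt : ∀ x, f x ≤ min (f x) (g x) + 4⁻¹ * (f x ^ 2 / g x) := by
    intro x
    have h0 : 0 ≤ f x ^ 2 / g x := div_nonneg (sq_nonneg _) (hg0 x).le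
    rcases le_total (f x) (g x) with h | h
    · rw [min_eq_left h]; linarith
    · rw [min_eq_right h]
      have : f x - g x - 4⁻¹ * (f x ^ 2 / g x) = -((f x - 2 * g x) ^ 2 / (4 * g x)) := by
        have := (hg0 x).ne'
        field_simp
        ring
      have h1 : 0 ≤ (f x - 2 * g x) ^ 2 / (4 * g x) :=
        div_nonneg (sq_nonneg _) (by linarith [hg0 x])
      linarith
  have hmin : ∫⁻ x, ENNReal.ofReal (min (f x) (g x)) ∂μ ≤
      μ.withDensity (fun x => ENNReal.ofReal (f x)) A +
      μ.withDensity (fun x => ENNReal.ofReal (g x)) Aᶜ := by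
    rw [withDensity_apply _ hA, withDensity_apply _ hA.compl, ← lintegral_add_compl _ hA]
    gcongr
    · exact min_le_left _ _
    · exact min_le_right _ _
  refine le_trans ?_ hmin
  have hone : 1 ≤ ∫⁻ x, ENNReal.ofReal (min (f x) (g x)) ∂μ + 2⁻¹ := by
    calc (1 : ℝ≥0∞) = ∫⁻ x, ENNReal.ofReal (f x) ∂μ := hf1.symm
      _ ≤ ∫⁻ x, ENNReal.ofReal (min (f x) (g x)) +
            ENNReal.ofReal 4⁻¹ * ENNReal.ofReal (f x ^ 2 / g x) ∂μ := by
          refine lintegral_mono fun x => ?_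
          have h0 : 0 ≤ f x ^ 2 / g x := div_nonneg (sq_nonneg _) (hg0 x).le
          rw [← ENNReal.ofReal_mul (by norm_num),
            ← ENNReal.ofReal_add (le_min (hf0 x) (hg0 x).le) (by positivity)]
          exact ENNReal.ofReal_le_ofReal (hpt x)
      _ = ∫⁻ x, ENNReal.ofReal (min (f x) (g x)) ∂μ +
            ENNReal.ofReal 4⁻¹ * ∫⁻ x, ENNReal.ofReal (f x ^ 2 / g x) ∂μ := by
          rw [lintegral_add_left (by fun_prop), lintegral_const_mul _ (by fun_prop)]
      _ ≤ _ := by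
          gcongr
          refine (mul_le_mul_right hfg _).trans (le_of_eq ?_)
          rw [show (2 : ℝ≥0∞) = ENNReal.ofReal 2 by norm_num, ← ENNReal.ofReal_mul (by norm_num),
            ← ENNReal.ofReal_inv_of_pos (by norm_num)]
          norm_num
  have h2 : (1 : ℝ≥0∞) - 2⁻¹ = 2⁻¹ := ENNReal.one_sub_inv_two
  rw [← h2]
  exact tsub_le_iff_right.2 hone

lemma half_le_map_observe_add_compl {n p : ℕ} {σ : ℝ} (hσ : 0 < σ)
    {β β' : EuclideanSpace ℝ (Fin p)}
    (h : likelihoodMoment (Real.toNNReal (σ ^ 2)) β β' ^ n ≤ 2)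
    {A : Set (Data n p)} (hA : MeasurableSet A) :
    1 / 2 ≤ ((sampleLaw n p σ).map (observe (β, -β))).real A +
      ((sampleLaw n p σ).map (observe (β', -β'))).real Aᶜ := by
  have hprob : ∀ θ : Regressors p, IsProbabilityMeasure ((sampleLaw n p σ).map (observe θ)) :=
    fun θ => Measure.isProbabilityMeasure_map (measurable_observe θ).aemeasurable
  have hone := measure_univ (μ := (sampleLaw n p σ).map (observe (β, -β)))
  rw [map_observe_neg hσ, withDensity_apply _ .univ, setLIntegral_univ] at hone
  have key := half_le_withDensity_add_compl (measurable_likelihood (n := n) _ β)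
    (measurable_likelihood _ β') (fun q => (likelihood_pos _ _ q).le) (likelihood_pos _ _)
    hone ((lintegral_likelihood_sq_div _ β β').trans_le h) hA
  rw [← map_observe_neg hσ, ← map_observe_neg hσ] at key
  have := ENNReal.toReal_mono (by finiteness) key
  rw [ENNReal.toReal_add (by finiteness) (by finiteness)] at this
  simpa [measureReal_def] using this

/-! ### The hypercube and the decoding of signs -/

/-- A vertex of the hypercube with edge `2ε` centred at `g` times the `i`-th basis vector and
orthogonal to it. -/
noncomputable def vertex {p : ℕ} (i : Fin p) (g ε : ℝ) (τ : Fin p → Bool) :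
    EuclideanSpace ℝ (Fin p) :=
  WithLp.toLp 2 fun j => if j = i then g else if τ j then ε else -ε

lemma vertex_self {p : ℕ} (i : Fin p) (g ε : ℝ) (τ : Fin p → Bool) : vertex i g ε τ i = g := by
  simp [vertex]

lemma vertex_of_ne {p : ℕ} {i j : Fin p} (h : j ≠ i) (g ε : ℝ) (τ : Fin p → Bool) :
    vertex i g ε τ j = if τ j then ε else -ε := by
  simp [vertex, h]

lemma le_norm_vertex {p : ℕ} (i : Fin p) (g ε : ℝ) (τ : Fin p → Bool) :
    g ≤ ‖vertex i g ε τ‖ := by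
  have := PiLp.norm_apply_le (vertex i g ε τ) i
  rw [vertex_self] at this
  exact (le_abs_self g).trans this

lemma norm_vertex_sq_le {p : ℕ} (i : Fin p) (g ε : ℝ) (τ : Fin p → Bool) :
    ‖vertex i g ε τ‖ ^ 2 ≤ g ^ 2 + p * ε ^ 2 := by
  rw [EuclideanSpace.real_norm_sq_eq]
  calc ∑ j, vertex i g ε τ j ^ 2 ≤ ∑ j, ((if j = i then g ^ 2 else 0) + ε ^ 2) := by
        refine Finset.sum_le_sum fun j _ => ?_
        by_cases h : j = i
        · rw [h, vertex_self, if_pos rfl]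
          linarith [sq_nonneg ε]
        · rw [vertex_of_ne h, if_neg h]
          split_ifs <;> simp
    _ = _ := by
        rw [Finset.sum_add_distrib]
        simp

lemma norm_vertex_add_sq_le {p : ℕ} (i : Fin p) (g ε : ℝ) (τ τ' : Fin p → Bool) :
    ‖vertex i g ε τ + vertex i g ε τ'‖ ^ 2 ≤ 4 * (g ^ 2 + p * ε ^ 2) := by
  have h := norm_add_le (vertex i g ε τ) (vertex i g ε τ')
  have h1 := norm_vertex_sq_le i g ε τ
  have h2 := norm_vertex_sq_le i g ε τ'
  have h3 := pow_le_pow_left₀ (norm_nonneg _) h 2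
  nlinarith [sq_nonneg (‖vertex i g ε τ‖ - ‖vertex i g ε τ'‖)]

lemma vertex_add_ne_zero {p : ℕ} (i : Fin p) {g : ℝ} (hg : 0 < g) (ε : ℝ) (τ τ' : Fin p → Bool) :
    vertex i g ε τ + vertex i g ε τ' ≠ 0 := by
  intro h
  have := congrArg (fun w : EuclideanSpace ℝ (Fin p) => w i) h
  simp only [PiLp.add_apply, vertex_self, PiLp.zero_apply] at this
  linarith

/-- The sign pattern with its `j`-th entry flipped. -/
def flipSign {p : ℕ} (j : Fin p) (τ : Fin p → Bool) : Fin p → Bool :=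
  Function.update τ j (!τ j)

lemma flipSign_involutive {p : ℕ} (j : Fin p) : Function.Involutive (flipSign j) := by
  intro τ
  simp [flipSign]

lemma norm_vertex_sub_flipSign {p : ℕ} {i j : Fin p} (h : j ≠ i) (g : ℝ) {ε : ℝ} (hε : 0 ≤ ε)
    (τ : Fin p → Bool) : ‖vertex i g ε τ - vertex i g ε (flipSign j τ)‖ = 2 * ε := by
  have : vertex i g ε τ - vertex i g ε (flipSign j τ) =
      EuclideanSpace.single j (if τ j then 2 * ε else -(2 * ε)) := by
    ext k
    rw [PiLp.sub_apply, PiLp.single_apply]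
    by_cases hk : k = i
    · rw [hk, vertex_self, vertex_self, if_neg h.symm, sub_self]
    · rw [vertex_of_ne hk, vertex_of_ne hk]
      by_cases hkj : k = j
      · subst hkj
        cases hτ : τ k <;> simp [flipSign, hτ] <;> ring
      · simp [flipSign, hkj]
  rw [this, PiLp.norm_single]
  split_ifs <;> simp [abs_of_nonneg hε]

lemma neg_pair_mem_paramClass {p : ℕ} {γ : ℝ} {β : EuclideanSpace ℝ (Fin p)} (h : γ ≤ 2 * ‖β‖) :
    (β, -β) ∈ paramClass p γ := by
  have h2 : β - -β = (2 : ℝ) • β := by rw [sub_neg_eq_add, two_smul]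
  refine ⟨?_, ?_⟩
  · simp only [h2, norm_neg, norm_smul, Real.norm_ofNat]
    linarith [norm_nonneg β]
  · simp only [norm_neg]
    linarith

/-- The sign pattern read off from an estimated regressor, after normalizing the sign of its
`i`-th coordinate. -/
noncomputable def decode {p : ℕ} (i : Fin p) (b : EuclideanSpace ℝ (Fin p)) (j : Fin p) : Bool :=
  decide (0 ≤ b i ↔ 0 ≤ b j)

lemma measurable_decode {p : ℕ} (i j : Fin p) :
    Measurable fun b : EuclideanSpace ℝ (Fin p) => decode i b j := by
  refine measurable_to_bool ?_
  have : (fun b : EuclideanSpace ℝ (Fin p) => decode i b j) ⁻¹' {true} =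
      {b | 0 ≤ b i ↔ 0 ≤ b j} := by
    ext b; simp [decode]
  rw [this]
  exact (measurableSet_le measurable_const (by fun_prop)).iff
    (measurableSet_le measurable_const (by fun_prop))

/-- The coordinates other than `i` at which the decoded sign pattern differs from `τ`. -/
noncomputable def decodeErrors {p : ℕ} (i : Fin p) (b : EuclideanSpace ℝ (Fin p))
    (τ : Fin p → Bool) : Finset (Fin p) :=
  (Finset.univ.erase i).filter fun j => decode i b j ≠ τ j

lemma card_mul_sq_le_norm_sq {p : ℕ} {w : EuclideanSpace ℝ (Fin p)} {s : Finset (Fin p)} {ε : ℝ}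
    (h : ∀ j ∈ s, ε ^ 2 ≤ w j ^ 2) : s.card * ε ^ 2 ≤ ‖w‖ ^ 2 := by
  rw [EuclideanSpace.real_norm_sq_eq, ← nsmul_eq_mul]
  exact (Finset.card_nsmul_le_sum s _ _ h).trans
    (Finset.sum_le_sum_of_subset_of_nonneg (Finset.subset_univ s) fun j _ _ => sq_nonneg _)

/-- Both bounds are needed because ρ may match b with β or with -β. If b has the wrong sign at i,
that coordinate alone contributes g², which exceeds pε² and hence the cost of all errors. If it has
the right sign, every wrongly decoded coordinate contributes at least ε². -/
lemma card_decodeErrors_mul_sq_le {p : ℕ} (i : Fin p) {g ε : ℝ} (hg : 0 < g) (hε : 0 < ε)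
    (hgε : p * ε ^ 2 ≤ g ^ 2) (b : EuclideanSpace ℝ (Fin p)) (τ : Fin p → Bool) :
    (decodeErrors i b τ).card * ε ^ 2 ≤ ‖vertex i g ε τ - b‖ ^ 2 ∧
      (decodeErrors i b τ).card * ε ^ 2 ≤ ‖vertex i g ε τ + b‖ ^ 2 := by
  have hcard : ((decodeErrors i b τ).card : ℝ) * ε ^ 2 ≤ g ^ 2 := by
    refine le_trans ?_ hgε
    gcongr
    simpa using Finset.card_le_univ (decodeErrors i b τ)
  have hfar : ∀ w : EuclideanSpace ℝ (Fin p), g ≤ w i →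
      (decodeErrors i b τ).card * ε ^ 2 ≤ ‖w‖ ^ 2 := by
    intro w hw
    have h1 : g ≤ ‖w‖ := hw.trans ((le_abs_self _).trans (PiLp.norm_apply_le w i))
    exact hcard.trans (pow_le_pow_left₀ hg.le h1 2)
  have hmem : ∀ j ∈ decodeErrors i b τ, j ≠ i ∧ decode i b j ≠ τ j := by
    intro j hj
    simpa [decodeErrors] using hj
  rcases le_or_gt 0 (b i) with hb | hb
  · refine ⟨card_mul_sq_le_norm_sq fun j hj => ?_, hfar _ ?_⟩
    · obtain ⟨hji, hd⟩ := hmem j hj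
      rw [PiLp.sub_apply, vertex_of_ne hji]
      cases hτ : τ j
      · have h0 : 0 ≤ b j := by simpa [decode, hb, hτ] using hd
        simp only [Bool.false_eq_true, if_false]
        nlinarith
      · have h0 : b j < 0 := by simpa [decode, hb, hτ] using hd
        simp only [if_true]
        nlinarith
    · rw [PiLp.add_apply, vertex_self]
      linarith
  · refine ⟨hfar _ ?_, card_mul_sq_le_norm_sq fun j hj => ?_⟩
    · rw [PiLp.sub_apply, vertex_self]
      linarith
    · obtain ⟨hji, hd⟩ := hmem j hj
      rw [PiLp.add_apply, vertex_of_ne hji]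
      cases hτ : τ j
      · have h0 : b j < 0 := by simpa [decode, hb, hτ, not_le.2 hb] using hd
        simp only [Bool.false_eq_true, if_false]
        nlinarith
      · have h0 : 0 ≤ b j := by simpa [decode, hb, hτ, not_le.2 hb] using hd
        simp only [if_true]
        nlinarith

lemma mul_card_decodeErrors_le_rho {p : ℕ} (i : Fin p) {g ε : ℝ} (hg : 0 < g) (hε : 0 < ε)
    (hgε : p * ε ^ 2 ≤ g ^ 2) (θ : Regressors p) (τ : Fin p → Bool) :
    ε / √p * (decodeErrors i θ.1 τ).card ≤ rho (vertex i g ε τ, -vertex i g ε τ) θ := by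
  obtain ⟨h1, h2⟩ := card_decodeErrors_mul_sq_le i hg hε hgε θ.1 τ
  set H := ((decodeErrors i θ.1 τ).card : ℝ) with hH
  have hH0 : 0 ≤ H := by positivity
  have hHp : H ≤ p := by
    rw [hH]
    exact_mod_cast (by simpa using Finset.card_le_univ (decodeErrors i θ.1 τ))
  have hp : (0 : ℝ) < p := by exact_mod_cast i.pos
  -- Using H ≤ p, the bound √H·ε is weakened to one linear in H, so that expectations can be summed
  -- bit by bit.
  have hsq : (ε / √p * H) ^ 2 ≤ H * ε ^ 2 := by
    rw [mul_pow, div_pow, Real.sq_sqrt hp.le, div_mul_eq_mul_div, div_le_iff₀ hp]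
    nlinarith [mul_le_mul_of_nonneg_left hHp (mul_nonneg hH0 (sq_nonneg ε))]
  refine le_min ?_ ?_
  · have := abs_le_of_sq_le_sq' (hsq.trans h1) (norm_nonneg _)
    exact this.2.trans (le_add_of_nonneg_right (norm_nonneg _))
  · have h3 : ‖-vertex i g ε τ - θ.1‖ = ‖vertex i g ε τ + θ.1‖ := by
      rw [← norm_neg]; congr 1; abel
    have := abs_le_of_sq_le_sq' (hsq.trans h2) (norm_nonneg _)
    simp only [h3]
    exact this.2.trans (le_add_of_nonneg_left (norm_nonneg _))

lemma ofReal_sum_measureReal_le_risk {n p : ℕ} (σ : ℝ) (i : Fin p) {g ε : ℝ} (hg : 0 < g)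
    (hε : 0 < ε) (hgε : p * ε ^ 2 ≤ g ^ 2) {est : Data n p → Regressors p} (hest : Measurable est)
    (τ : Fin p → Bool) :
    ENNReal.ofReal (ε / √p * ∑ j ∈ Finset.univ.erase i,
      ((sampleLaw n p σ).map (observe (vertex i g ε τ, -vertex i g ε τ))).real
        {q | decode i (est q).1 j ≠ τ j}) ≤
      risk σ est (vertex i g ε τ, -vertex i g ε τ) := by
  set θ : Regressors p := (vertex i g ε τ, -vertex i g ε τ)
  have hB : ∀ j, MeasurableSet {q | decode i (est q).1 j ≠ τ j} := fun j =>
    ((measurable_decode i j).comp hest.fst) (measurableSet_singleton (τ j)).compl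
  have hprob : IsProbabilityMeasure ((sampleLaw n p σ).map (observe θ)) :=
    Measure.isProbabilityMeasure_map (measurable_observe θ).aemeasurable
  rw [ENNReal.ofReal_mul (by positivity), ENNReal.ofReal_sum_of_nonneg fun _ _ => measureReal_nonneg]
  have hreal : ∀ s, ENNReal.ofReal (((sampleLaw n p σ).map (observe θ)).real s) =
      (sampleLaw n p σ).map (observe θ) s := fun s => ofReal_measureReal
  simp_rw [hreal]
  calc _ = ∫⁻ q, ENNReal.ofReal (ε / √p) * ∑ j ∈ Finset.univ.erase i,
          Set.indicator {q | decode i (est q).1 j ≠ τ j} 1 q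
          ∂((sampleLaw n p σ).map (observe θ)) := by
        rw [lintegral_const_mul _ (Finset.measurable_sum _ fun j _ =>
          measurable_one.indicator (hB j)), lintegral_finsetSum _ fun j _ =>
          measurable_one.indicator (hB j)]
        simp_rw [lintegral_indicator_one (hB _)]
    _ = ∫⁻ q, ENNReal.ofReal (ε / √p * (decodeErrors i (est q).1 τ).card)
          ∂((sampleLaw n p σ).map (observe θ)) := by
        refine lintegral_congr fun q => ?_
        rw [ENNReal.ofReal_mul (by positivity), ENNReal.ofReal_natCast, decodeErrors,
          Finset.card_filter]
        push_cast
        simp only [Set.indicator_apply, Set.mem_ofPred_eq, Pi.one_apply]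
    _ ≤ ∫⁻ ω, ENNReal.ofReal (ε / √p * (decodeErrors i (est (observe θ ω)).1 τ).card)
          ∂sampleLaw n p σ := lintegral_map_le _ _
    _ ≤ _ := lintegral_mono fun ω =>
        ENNReal.ofReal_le_ofReal (mul_card_decodeErrors_le_rho i hg hε hgε _ τ)

/-! ### Assouad's bound -/

/-- Assouad's bound for the minimax risk, over the hypercube of parameters `(β, -β)`. -/
lemma le_minimaxRisk_of_likelihoodMoment_le {n p : ℕ} {σ γ g ε : ℝ} (hσ : 0 < σ) (i : Fin p)
    (hp : 2 ≤ p) (hg : 0 < g) (hγ : γ ≤ 2 * g) (hε : 0 < ε) (hgε : p * ε ^ 2 ≤ g ^ 2)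
    (hmoment : ∀ (τ : Fin p → Bool) (j : Fin p), j ≠ i →
      likelihoodMoment (Real.toNNReal (σ ^ 2)) (vertex i g ε τ) (vertex i g ε (flipSign j τ)) ^ n ≤ 2) :
    ENNReal.ofReal (ε * √p / 8) ≤ minimaxRisk n p σ γ := by
  refine le_iInf₂ fun est hest => ?_
  set P : (Fin p → Bool) → Measure (Data n p) := fun τ =>
    (sampleLaw n p σ).map (observe (vertex i g ε τ, -vertex i g ε τ))
  set f : Fin p → (Fin p → Bool) → ℝ := fun j τ =>
    (P τ).real {q | decode i (est q).1 j ≠ τ j} with hf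
  have hpair : ∀ j ∈ Finset.univ.erase i, ∀ τ, 1 / 2 ≤ f j τ + f j (flipSign j τ) := by
    intro j hj τ
    have hB : MeasurableSet {q | decode i (est q).1 j ≠ τ j} :=
      ((measurable_decode i j).comp hest.fst) (measurableSet_singleton (τ j)).compl
    have h := half_le_map_observe_add_compl hσ (hmoment τ j (Finset.ne_of_mem_erase hj)) hB
    have hcompl : {q | decode i (est q).1 j ≠ τ j}ᶜ =
        {q | decode i (est q).1 j ≠ flipSign j τ j} := by
      ext q
      simp [flipSign]
    rwa [hcompl] at h
  have hsum : ∀ j ∈ Finset.univ.erase i, ∑ _τ : Fin p → Bool, (1 / 4 : ℝ) ≤ ∑ τ, f j τ := by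
    intro j hj
    have h1 := Finset.sum_le_sum fun τ (_ : τ ∈ Finset.univ) => hpair j hj τ
    -- Flipping bit j permutes the cube, so both terms have the same sum and the average error of
    -- bit j is at least 1/4.
    rw [Finset.sum_add_distrib,
      Function.Bijective.sum_comp (flipSign_involutive j).bijective (fun τ => f j τ)] at h1
    have h2 : ∑ _τ : Fin p → Bool, (1 / 2 : ℝ) = 2 * ∑ _τ : Fin p → Bool, (1 / 4 : ℝ) := by
      rw [Finset.mul_sum]; norm_num
    linarith
  have havg : ∑ _τ : Fin p → Bool, ((p - 1) * (1 / 4) : ℝ) ≤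
      ∑ τ, ∑ j ∈ Finset.univ.erase i, f j τ := by
    rw [Finset.sum_comm]
    refine le_trans (le_of_eq ?_) (Finset.sum_le_sum hsum)
    rw [Finset.sum_const (s := Finset.univ.erase i), ← Finset.mul_sum,
      Finset.card_erase_of_mem (Finset.mem_univ i), Finset.card_univ, Fintype.card_fin,
      nsmul_eq_mul, Nat.cast_pred i.pos]
  obtain ⟨τ, -, hτ⟩ := Finset.exists_le_of_sum_le Finset.univ_nonempty havg
  have hmem : (vertex i g ε τ, -vertex i g ε τ) ∈ paramClass p γ :=
    neg_pair_mem_paramClass (hγ.trans (by linarith [le_norm_vertex i g ε τ]))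
  refine le_trans ?_ (le_iSup₂ (f := fun θ (_ : θ ∈ paramClass p γ) => risk σ est θ) _ hmem)
  refine le_trans (ENNReal.ofReal_le_ofReal ?_)
    (ofReal_sum_measureReal_le_risk σ i hg hε hgε hest τ)
  have hp2 : (2 : ℝ) ≤ p := by exact_mod_cast hp
  have hp0 : (0 : ℝ) < √p := Real.sqrt_pos.2 (by linarith)
  calc ε * √p / 8 = ε / √p * (√p ^ 2 / 8) := by field_simp
    _ = ε / √p * (p / 8) := by rw [Real.sq_sqrt (by linarith)]
    -- Only p - 1 coordinates are free, and p - 1 ≥ p/2.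
    _ ≤ ε / √p * ((p - 1) * (1 / 4)) := by gcongr; linarith
    _ ≤ _ := by gcongr

/-! ### Choice of the scale in the two signal regimes -/

lemma minimaxRisk_mono {n p : ℕ} {σ γ γ' : ℝ} (h : γ ≤ γ') :
    minimaxRisk n p σ γ' ≤ minimaxRisk n p σ γ :=
  iInf₂_mono fun _ _ => biSup_mono fun _ hθ => ⟨hθ.1, h.trans hθ.2⟩

/-- An excess of 1/(2n) per observation gives (1 + 1/(2n))ⁿ ≤ exp(1/2) ≤ 2. -/
lemma pow_le_two_of_le_one_add {n : ℕ} (hn : 0 < n) {M : ℝ≥0∞} {x : ℝ} (hx : 0 ≤ x)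
    (hM : M ≤ 1 + ENNReal.ofReal x * momentBound)
    (hxK : x * momentBound.toReal ≤ 1 / (2 * n)) : M ^ n ≤ 2 := by
  have hn' : (0 : ℝ) < n := by exact_mod_cast hn
  have h1 : M ≤ ENNReal.ofReal (1 + 1 / (2 * n)) := by
    refine hM.trans ?_
    rw [← ENNReal.ofReal_toReal momentBound_ne_top, ← ENNReal.ofReal_mul hx, ← ENNReal.ofReal_one,
      ← ENNReal.ofReal_add zero_le_one (by positivity)]
    exact ENNReal.ofReal_le_ofReal (by linarith)
  refine (pow_le_pow_left₀ zero_le h1 n).trans ?_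
  rw [← ENNReal.ofReal_pow (by positivity), show (2 : ℝ≥0∞) = ENNReal.ofReal 2 by norm_num]
  refine ENNReal.ofReal_le_ofReal ?_
  have h2 : (1 + 1 / (2 * n) : ℝ) ≤ Real.exp (1 / (2 * n)) := by
    linarith [Real.add_one_le_exp (1 / (2 * n) : ℝ)]
  calc (1 + 1 / (2 * n) : ℝ) ^ n ≤ Real.exp (1 / (2 * n)) ^ n := by gcongr
    _ = Real.exp (1 / 2) := by
        rw [← Real.exp_nat_mul]; congr 1; field_simp
    _ ≤ 2 := by
        have h3 : Real.exp (1 / 2) ^ 2 = Real.exp 1 := by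
          rw [← Real.exp_nat_mul]; norm_num
        have h4 := Real.exp_one_lt_d9
        nlinarith [Real.exp_pos (1 / 2)]

/-- The scale of the hypercubes used in the lower bounds. -/
noncomputable def scale : ℝ := 1 / (8 * (1 + momentBound.toReal))

lemma scale_pos : 0 < scale := by
  unfold scale
  positivity

lemma scale_le : scale ≤ 1 / 8 := by
  unfold scale
  have : 0 ≤ momentBound.toReal := ENNReal.toReal_nonneg
  gcongr
  linarith

/-- The factor 32 is 4 · 8: adjacent vertices have squared distance 4ε², and their sum has squared
norm at most 8γ². -/
lemma scale_sq_mul_le : 32 * scale ^ 2 * momentBound.toReal ≤ 1 / 2 := by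
  unfold scale
  have : 0 ≤ momentBound.toReal := ENNReal.toReal_nonneg
  rw [div_pow, one_pow, mul_one_div, div_mul_eq_mul_div, div_le_iff₀ (by positivity)]
  nlinarith

lemma toNNReal_sq_coe (σ : ℝ) : ((Real.toNNReal (σ ^ 2) : NNReal) : ℝ) = σ ^ 2 :=
  Real.coe_toNNReal _ (sq_nonneg σ)

lemma le_minimaxRisk_of_separated {n p : ℕ} {σ γ : ℝ} (hσ : 0 < σ) (hp : 2 ≤ p) (hpn : p ≤ n)
    (hγ : σ / 8 ≤ γ) :
    ENNReal.ofReal (scale / 8 * σ * √((p : ℝ) / n)) ≤ minimaxRisk n p σ γ := by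
  have hp0 : (0 : ℝ) < p := by exact_mod_cast (by omega : 0 < p)
  have hn : 0 < n := by omega
  have hn0 : (0 : ℝ) < n := by exact_mod_cast hn
  have hn1 : (1 : ℝ) ≤ n := by exact_mod_cast hn
  have hpn' : (p : ℝ) ≤ n := by exact_mod_cast hpn
  have hs := scale_pos
  have hs8 := scale_le
  have hv : Real.toNNReal (σ ^ 2) ≠ 0 := (Real.toNNReal_pos.2 (by positivity)).ne'
  -- Chosen so that (2ε)²/σ² = 4 `scale`²/n; then p ≤ n and σ/8 ≤ γ give pε² ≤ γ².
  set ε := scale * σ / √n with hε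
  have hε0 : 0 < ε := by positivity
  have hε2 : ε ^ 2 = scale ^ 2 * σ ^ 2 / n := by
    rw [hε, div_pow, Real.sq_sqrt hn0.le, mul_pow]
  have hγ0 : 0 < γ := by linarith
  have hsq : scale ^ 2 ≤ 1 / 64 := by nlinarith
  have hvol : p * ε ^ 2 ≤ γ ^ 2 := by
    have h1 : p * ε ^ 2 ≤ scale ^ 2 * σ ^ 2 := by
      rw [hε2, ← mul_div_assoc, div_le_iff₀ hn0, mul_comm]
      gcongr
    nlinarith [mul_le_mul_of_nonneg_right hsq (sq_nonneg σ)]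
  have hεσ : (2 * ε) ^ 2 ≤ σ ^ 2 / 8 := by
    have h1 : ε ^ 2 ≤ scale ^ 2 * σ ^ 2 := by
      rw [hε2]
      exact div_le_self (by positivity) hn1
    nlinarith [mul_le_mul_of_nonneg_right hsq (sq_nonneg σ)]
  refine le_trans (le_of_eq ?_) (le_minimaxRisk_of_likelihoodMoment_le (γ := γ) hσ
    ⟨0, by omega⟩ hp hγ0 (by linarith) hε0 hvol fun τ j hj => ?_)
  · rw [hε, Real.sqrt_div hp0.le]
    congr 1
    ring
  · have hnorm := norm_vertex_sub_flipSign hj γ hε0.le τ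
    have hne : vertex ⟨0, by omega⟩ γ ε τ ≠ vertex ⟨0, by omega⟩ γ ε (flipSign j τ) := by
      rw [← sub_ne_zero, ← norm_ne_zero_iff, hnorm]
      positivity
    have h := likelihoodMoment_le_of_norm_sub hv hne (by rw [hnorm, toNNReal_sq_coe]; exact hεσ)
    rw [hnorm, toNNReal_sq_coe] at h
    refine pow_le_two_of_le_one_add hn (by positivity) h ?_
    have e1 : (2 * ε) ^ 2 / σ ^ 2 = 4 * scale ^ 2 / n := by
      rw [mul_pow, hε2]; field_simp; norm_num
    rw [e1, div_mul_eq_mul_div, div_le_div_iff₀ hn0 (by positivity)]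
    have := scale_sq_mul_le
    have h0 : 0 ≤ scale ^ 2 * momentBound.toReal := by positivity
    nlinarith

lemma le_minimaxRisk_of_overlapping {n p : ℕ} {σ γ : ℝ} (hσ : 0 < σ) (hp : 64 ≤ p) (hpn : p ≤ n)
    (hγ0 : 0 < γ) (hγ : γ ≤ σ / 8) (hlow : σ ^ 4 * (p / n) ≤ 16 * γ ^ 4) :
    ENNReal.ofReal (scale / 8 * (σ ^ 2 / γ) * √((p : ℝ) / n)) ≤ minimaxRisk n p σ γ := by
  have hp64 : (64 : ℝ) ≤ p := by exact_mod_cast hp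
  have hp0 : (0 : ℝ) < p := by linarith
  have hn : 0 < n := by omega
  have hn0 : (0 : ℝ) < n := by exact_mod_cast hn
  have hs := scale_pos
  have hs8 := scale_le
  have hv : Real.toNNReal (σ ^ 2) ≠ 0 := (Real.toNNReal_pos.2 (by positivity)).ne'
  -- Chosen so that (2ε)²/σ² · 8γ²/σ² = 32 `scale`²/n; the condition pε² ≤ γ² is then where `hlow`
  -- enters.
  set ε := scale * (σ ^ 2 / γ) / √n with hε
  have hε0 : 0 < ε := by positivity
  have hε2 : ε ^ 2 = scale ^ 2 * σ ^ 4 / (γ ^ 2 * n) := by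
    rw [hε, div_pow, Real.sq_sqrt hn0.le]
    field_simp
  have hsq : scale ^ 2 ≤ 1 / 64 := by nlinarith
  have hvol : p * ε ^ 2 ≤ γ ^ 2 := by
    have h1 : p * ε ^ 2 * γ ^ 2 = scale ^ 2 * (σ ^ 4 * (p / n)) := by
      rw [hε2]; field_simp
    have h2 : scale ^ 2 * (σ ^ 4 * (p / n)) ≤ 1 / 64 * (16 * γ ^ 4) :=
      mul_le_mul hsq hlow (by positivity) (by norm_num)
    have h3 : p * ε ^ 2 * γ ^ 2 ≤ γ ^ 2 * γ ^ 2 := by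
      rw [h1]
      nlinarith [pow_pos hγ0 4]
    exact le_of_mul_le_mul_right h3 (by positivity)
  -- The threshold σ/8 is exactly what turns ‖β + β'‖² ≤ 8γ² into ‖β + β'‖² ≤ σ²/8.
  have hγσ : γ ^ 2 ≤ σ ^ 2 / 64 := by nlinarith
  have hεσ : (2 * ε) ^ 2 ≤ σ ^ 2 / 8 := by nlinarith [sq_nonneg ε]
  refine le_trans (le_of_eq ?_) (le_minimaxRisk_of_likelihoodMoment_le (γ := γ) hσ
    ⟨0, by omega⟩ (by omega) hγ0 (by linarith) hε0 hvol fun τ j hj => ?_)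
  · rw [hε, Real.sqrt_div hp0.le]
    congr 1
    ring
  · have hnorm := norm_vertex_sub_flipSign hj γ hε0.le τ
    have hne : vertex ⟨0, by omega⟩ γ ε τ ≠ vertex ⟨0, by omega⟩ γ ε (flipSign j τ) := by
      rw [← sub_ne_zero, ← norm_ne_zero_iff, hnorm]
      positivity
    have hadd : ‖vertex ⟨0, by omega⟩ γ ε τ + vertex ⟨0, by omega⟩ γ ε (flipSign j τ)‖ ^ 2 ≤
        8 * γ ^ 2 :=
      (norm_vertex_add_sq_le _ _ _ _ _).trans (by linarith)
    have h := likelihoodMoment_le_of_norm_add hv hne (vertex_add_ne_zero _ hγ0 _ _ _)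
      (by rw [hnorm, toNNReal_sq_coe]; exact hεσ)
      (by rw [toNNReal_sq_coe]; linarith)
    rw [hnorm, toNNReal_sq_coe] at h
    refine pow_le_two_of_le_one_add hn (by positivity) h ?_
    calc _ ≤ (2 * ε) ^ 2 / σ ^ 2 * (8 * γ ^ 2 / σ ^ 2) * momentBound.toReal := by gcongr
      _ = 32 * scale ^ 2 * momentBound.toReal / n := by
          rw [mul_pow, hε2]; field_simp; ring
      _ ≤ 1 / 2 / n := by gcongr; exact scale_sq_mul_le
      _ = _ := by rw [div_div]

end MixedRegression

/-! ### Assembling the three regimes -/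

theorem theorem6 :
    ∃ c₀ c₁ : ℝ, 0 < c₀ ∧ c₀ < 1 ∧ 0 < c₁ ∧ c₁ < 1 ∧
      ∀ (n p : ℕ) (σ : ℝ), 64 ≤ p → p ≤ n → 0 < σ →
        (∀ γ : ℝ, σ < γ →
          ENNReal.ofReal (c₀ * σ * Real.sqrt ((p : ℝ) / (n : ℝ)))
            ≤ MixedRegression.minimaxRisk n p σ γ) ∧
        (∀ γ : ℝ, c₁ * σ * ((p : ℝ) / (n : ℝ)) ^ (1 / 4 : ℝ) ≤ γ → γ ≤ σ →
          ENNReal.ofReal (c₀ * (σ ^ 2 / γ) * Real.sqrt ((p : ℝ) / (n : ℝ)))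
            ≤ MixedRegression.minimaxRisk n p σ γ) ∧
        (∀ γ : ℝ, 0 < γ → γ ≤ c₁ * σ * ((p : ℝ) / (n : ℝ)) ^ (1 / 4 : ℝ) →
          ENNReal.ofReal (c₀ * σ * ((p : ℝ) / (n : ℝ)) ^ (1 / 4 : ℝ))
            ≤ MixedRegression.minimaxRisk n p σ γ) := by
  have hs := MixedRegression.scale_pos
  have hs8 := MixedRegression.scale_le
  -- One factor 1/8 comes from Assouad's bound; the other is lost for σ/8 ≤ γ ≤ σ, where the
  -- strong-signal bound is used and σ²/γ ≤ 8σ. The fourth power of 1/2 matches the 16 in the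
  -- weak-signal condition.
  refine ⟨MixedRegression.scale / 64, 1 / 2, by positivity, by linarith, by norm_num, by norm_num,
    fun n p σ hp hpn hσ => ?_⟩
  have hp0 : (0 : ℝ) < p := by exact_mod_cast (by omega : 0 < p)
  have hn0 : (0 : ℝ) < n := by exact_mod_cast (by omega : 0 < n)
  have hr0 : (0 : ℝ) < p / n := by positivity
  have hr1 : (p : ℝ) / n ≤ 1 := div_le_one_of_le₀ (by exact_mod_cast hpn) hn0.le
  set t := ((p : ℝ) / n) ^ (1 / 4 : ℝ) with ht
  have ht0 : 0 < t := Real.rpow_pos_of_pos hr0 _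
  have ht1 : t ≤ 1 := Real.rpow_le_one hr0.le hr1 (by norm_num)
  have ht4 : t ^ 4 = (p : ℝ) / n := by
    rw [ht, ← Real.rpow_natCast, ← Real.rpow_mul hr0.le]
    norm_num
  have hsqrt : √((p : ℝ) / n) = t ^ 2 := by
    rw [← ht4, show t ^ 4 = (t ^ 2) ^ 2 by ring, Real.sqrt_sq (by positivity)]
  have hmid : ∀ γ : ℝ, 1 / 2 * σ * t ≤ γ → γ ≤ σ →
      ENNReal.ofReal (MixedRegression.scale / 64 * (σ ^ 2 / γ) * √((p : ℝ) / n)) ≤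
        MixedRegression.minimaxRisk n p σ γ := by
    intro γ hlow hup
    have hγ0 : 0 < γ := lt_of_lt_of_le (by positivity) hlow
    rcases le_total (σ / 8) γ with h8 | h8
    · refine le_trans (ENNReal.ofReal_le_ofReal ?_)
        (MixedRegression.le_minimaxRisk_of_separated hσ (by omega) hpn h8)
      have h1 : σ ^ 2 / γ ≤ 8 * σ := by
        rw [div_le_iff₀ hγ0]; nlinarith
      calc _ ≤ MixedRegression.scale / 64 * (8 * σ) * √((p : ℝ) / n) := by gcongr
        _ = _ := by ring
    · refine le_trans (ENNReal.ofReal_le_ofReal ?_)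
        (MixedRegression.le_minimaxRisk_of_overlapping hσ hp hpn hγ0 h8 ?_)
      · gcongr
        norm_num
      · have h2 := pow_le_pow_left₀ (by positivity) hlow 4
        rw [← ht4]
        linarith [show (1 / 2 * σ * t) ^ 4 = σ ^ 4 * t ^ 4 / 16 by ring]
  refine ⟨fun γ hγ => ?_, hmid, fun γ _ hγ => ?_⟩
  · refine le_trans (ENNReal.ofReal_le_ofReal ?_)
      (MixedRegression.le_minimaxRisk_of_separated hσ (by omega) hpn (by linarith : σ / 8 ≤ γ))
    gcongr
    norm_num
  -- Below the threshold, compare with γ = σt/2, where (σ²/γ)t² = 2σt.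
  · refine le_trans ?_ ((hmid (1 / 2 * σ * t) le_rfl (by nlinarith)).trans
      (MixedRegression.minimaxRisk_mono hγ))
    refine ENNReal.ofReal_le_ofReal ?_
    rw [hsqrt]
    have h1 : MixedRegression.scale / 64 * (σ ^ 2 / (1 / 2 * σ * t)) * t ^ 2 =
        2 * (MixedRegression.scale / 64 * σ * t) := by
      field_simp
    rw [h1]
    linarith [show 0 < MixedRegression.scale / 64 * σ * t by positivity]
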